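/- Let $n\ge 1$ and let $\mathrm{Y}(n)=\mathrm{Y}(\mathfrak{gl}_n)$ be the Yangian, i.e. the unital associative algebra over $\mathbb{C}$ with generators $t_{ij}^{(r)}$ ($1\le i,j\le n$, $r\ge 1$) and defining relations $$[t^{(r+1)}_{ij},t^{(s)}_{kl}]-[t^{(r)}_{ij},t^{(s+1)}_{kl}]=t^{(r)}_{kj}t^{(s)}_{il}-t^{(s)}_{kj}t^{(r)}_{il},\qquad r,s\ge 0,\quad t^{(0)}_{ij}=\delta_{ij}.$$ Let $T(u)$ be the $n\times n$ matrix with entries $t_{ij}(u)=\sum_{r\ge 0}t^{(r)}_{ij}u^{-r}\in \mathrm{Y}(n)[[u^{-1}]]$, where shifted series such as $t_{ij}(u-c)$ are re-expanded in powers of $u^{-1}$. Let $T_a(u)$ denote $T(u)$ acting on the $a$-th copy of $\mathbb{C}^n$ in $(\mathbb{C}^n)^{\otimes n}$, and let $A_n$ be the antisymmetrizer, $A_n(e_{i_1}\otimes\cdots\otimes e_{i_n})=\sum_{\sigma\in\mathfrak{S}_n}\operatorname{sgn}\sigma\cdot e_{i_{\sigma(1)}}\otimes\cdots\otimes e_{i_{\sigma(n)}}$.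 The quantum determinant is the series $\operatorname{qdet}T(u)\in 1+u^{-1}\mathrm{Y}(n)[[u^{-1}]]$ such that $$A_n\,T_1(u)\cdots T_n(u-n+1)=T_n(u-n+1)\cdots T_1(u)\,A_n=A_n\,\operatorname{qdet}T(u).$$ For an invertible square matrix $X$ over a ring with $1$ such that $(X^{-1})_{ji}$ is invertible, the $ij$-th quasi-determinant is $|X|_{ij}=\big((X^{-1})_{ji}\big)^{-1}$. For $1\le m\le n$ let $T^{(m)}(u)$ be the submatrix of $T(u)$ formed by its first $m$ rows and columns. Then $\operatorname{qdet}T(u)$ exists and is unique, the quasi-determinants $|T^{(m)}(u-m+1)|_{mm}$ ($1\le m\le n$) over the ring $\mathrm{Y}(n)[[u^{-1}]]$ are defined, $|T^{(1)}(u)|_{11}=t_{11}(u)$, and in $\mathrm{Y}(n)[[u^{-1}]]$ one has $$\operatorname{qdet}T(u)=t_{11}(u)\,|T^{(2)}(u-1)|_{22}\cdots|T^{(n)}(u-n+1)|_{nn}.$$ Moreover, the factors $t_{11}(u),\ |T^{(2)}(u-1)|_{22},\ \dots,\ |T^{(n)}(u-n+1)|_{nn}$ commute pairwise. -/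

import Mathlib

/-! The Yangian of `gl_n` over `ℂ`. Formal power series in `u⁻¹` over a (noncommutative) algebra
`A` are elements of `PowerSeries A`, the variable `PowerSeries.X` standing for `u⁻¹`. Indices
`1, …, n` are represented by `Fin n = {0, …, n - 1}`. -/

namespace Yangian

noncomputable section

/-- The elements `t_{ij}^{(r)}` of the free algebra on the symbols `t_{ij}^{(1)}, t_{ij}^{(2)}, …`,
with the convention `t_{ij}^{(0)} = δ_{ij}`. The free generator with label `(i, j, r)` is
`t_{ij}^{(r+1)}`. -/
def freeT (n : ℕ) (i j : Fin n) : ℕ → FreeAlgebra ℂ (Fin n × Fin n × ℕ)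
  | 0 => if i = j then 1 else 0
  | r + 1 => FreeAlgebra.ι ℂ (i, j, r)

/-- The defining relations
`[t_{ij}^{(r+1)}, t_{kl}^{(s)}] - [t_{ij}^{(r)}, t_{kl}^{(s+1)}]
  = t_{kj}^{(r)} t_{il}^{(s)} - t_{kj}^{(s)} t_{il}^{(r)}`, for `r, s ≥ 0`. -/
inductive Rel (n : ℕ) :
    FreeAlgebra ℂ (Fin n × Fin n × ℕ) → FreeAlgebra ℂ (Fin n × Fin n × ℕ) → Prop
  | defining (i j k l : Fin n) (r s : ℕ) :
      Rel n
        ((freeT n i j (r + 1) * freeT n k l s - freeT n k l s * freeT n i j (r + 1)) -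
          (freeT n i j r * freeT n k l (s + 1) - freeT n k l (s + 1) * freeT n i j r))
        (freeT n k j r * freeT n i l s - freeT n k j s * freeT n i l r)

/-- The Yangian `Y(n) = Y(gl_n)`: the unital associative `ℂ`-algebra with generators
`t_{ij}^{(r)}`, `r ≥ 1`, and the defining relations `Rel n`. -/
abbrev Y (n : ℕ) : Type := RingQuot (Rel n)

/-- The element `t_{ij}^{(r)}` of the Yangian (with `t_{ij}^{(0)} = δ_{ij}`). -/
def t (n : ℕ) (i j : Fin n) (r : ℕ) : Y n := RingQuot.mkAlgHom ℂ (Rel n) (freeT n i j r)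

/-- The matrix `T(u)`, whose entries are the series
`t_{ij}(u) = δ_{ij} + t_{ij}^{(1)} u⁻¹ + t_{ij}^{(2)} u⁻² + ⋯`. -/
def T (n : ℕ) : Matrix (Fin n) (Fin n) (PowerSeries (Y n)) :=
  Matrix.of fun i j => PowerSeries.mk (t n i j)

/-- The expansion `(u - c)⁻¹ = u⁻¹ + c u⁻² + c² u⁻³ + ⋯`. -/
def shiftedVar (c : ℂ) : PowerSeries ℂ := PowerSeries.X * PowerSeries.mk fun k => c ^ k

/-- `shiftedVar c` is `u⁻¹ (1 - c u⁻¹)⁻¹`. -/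
theorem shiftedVar_mul (c : ℂ) :
    shiftedVar c * (1 - PowerSeries.C c * PowerSeries.X) = PowerSeries.X := by
  have h : (PowerSeries.mk fun k => c ^ k) * (1 - PowerSeries.C c * PowerSeries.X) = 1 := by
    ext m
    cases m with
    | zero => simp [mul_sub, PowerSeries.coeff_zero_eq_constantCoeff]
    | succ m =>
      rw [mul_sub, mul_one, mul_comm (PowerSeries.C c), ← mul_assoc]
      simp [PowerSeries.coeff_succ_mul_X, PowerSeries.coeff_one, pow_succ]
  rw [shiftedVar, mul_assoc, h, mul_one]

/-- The series `f(u - c) = ∑_r a_r (u - c)^{-r}`, re-expanded in powers of `u⁻¹`, where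
`f(u) = ∑_r a_r u^{-r}`. As `(u - c)^{-r}` starts with `u^{-r}`, only the terms with `r ≤ m`
contribute to the coefficient of `u^{-m}`. -/
def shift {A : Type*} [Ring A] [Algebra ℂ A] (c : ℂ) (f : PowerSeries A) : PowerSeries A :=
  PowerSeries.mk fun m =>
    ∑ r ∈ Finset.range (m + 1), PowerSeries.coeff m (shiftedVar c ^ r) • PowerSeries.coeff r f

/-- The matrix `T(u - c)`. -/
def shiftedT (n : ℕ) (c : ℂ) : Matrix (Fin n) (Fin n) (PowerSeries (Y n)) :=
  (T n).map (shift c)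

/-- For a matrix `X` over `R`, the element `X_a` of `R ⊗ (End ℂⁿ)^{⊗m}` in which `X` acts on the
`a`-th copy of `ℂⁿ`. The algebra `R ⊗ (End ℂⁿ)^{⊗m}` is realized by the matrices over `R` whose
rows and columns are indexed by multi-indices `Fin m → Fin n`, i.e. by the basis vectors
`e_{i_1} ⊗ ⋯ ⊗ e_{i_m}` of `(ℂⁿ)^{⊗m}`. -/
def onCopy {R : Type*} [Ring R] {n : ℕ} (m : ℕ) (X : Matrix (Fin n) (Fin n) R) (a : Fin m) :
    Matrix (Fin m → Fin n) (Fin m → Fin n) R :=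
  Matrix.of fun I J => if ∀ b, b ≠ a → I b = J b then X (I a) (J a) else 0

/-- The antisymmetrizer `A_m`, sending `e_{i_1} ⊗ ⋯ ⊗ e_{i_m}` to
`∑_σ sgn σ · e_{i_{σ(1)}} ⊗ ⋯ ⊗ e_{i_{σ(m)}}`. -/
def antisymmetrizer (R : Type*) [Ring R] (n m : ℕ) :
    Matrix (Fin m → Fin n) (Fin m → Fin n) R :=
  Matrix.of fun I J => ∑ σ : Equiv.Perm (Fin m),
    if I = J ∘ σ then ((Equiv.Perm.sign σ : ℤ) : R) else 0

/-- The list `T_1(u), T_2(u - 1), …, T_n(u - n + 1)`. -/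
def tList (n : ℕ) : List (Matrix (Fin n → Fin n) (Fin n → Fin n) (PowerSeries (Y n))) :=
  List.ofFn fun a : Fin n => onCopy n (shiftedT n (a.val : ℂ)) a

/-- `D` is the quantum determinant `qdet T(u)`: a series `1 + d_1 u⁻¹ + d_2 u⁻² + ⋯` over `Y(n)`
such that
`A_n T_1(u) ⋯ T_n(u - n + 1) = T_n(u - n + 1) ⋯ T_1(u) A_n = A_n D`. -/
structure IsQuantumDeterminant (n : ℕ) (D : PowerSeries (Y n)) : Prop where
  constantCoeff_eq : PowerSeries.constantCoeff D = 1
  antisymmetrizer_mul :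
    antisymmetrizer (PowerSeries (Y n)) n n * (tList n).prod =
      antisymmetrizer (PowerSeries (Y n)) n n * Matrix.scalar (Fin n → Fin n) D
  mul_antisymmetrizer :
    (tList n).reverse.prod * antisymmetrizer (PowerSeries (Y n)) n n =
      antisymmetrizer (PowerSeries (Y n)) n n * Matrix.scalar (Fin n → Fin n) D

/-- The `ij`-th quasi-determinant of the square matrix `X` is defined: `X` is invertible and the
`ji`-th entry of its inverse is invertible. -/
def HasQuasiDet {R : Type*} [Ring R] {m : ℕ} (X : Matrix (Fin m) (Fin m) R) (i j : Fin m) : Prop :=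
  IsUnit X ∧ IsUnit ((Ring.inverse X) j i)

/-- The `ij`-th quasi-determinant `|X|_{ij} = ((X⁻¹)_{ji})⁻¹`. Here `Ring.inverse` is the two-sided
inverse of an invertible element. -/
def quasiDet {R : Type*} [Ring R] {m : ℕ} (X : Matrix (Fin m) (Fin m) R) (i j : Fin m) : R :=
  Ring.inverse ((Ring.inverse X) j i)

/-- For `k = m - 1` in `{0, …, n - 1}`, the matrix `T^{(m)}(u - m + 1)` formed by the first `m` rows
and columns of `T(u - m + 1)`. -/
def leadingT (n : ℕ) (k : Fin n) :
    Matrix (Fin (k.val + 1)) (Fin (k.val + 1)) (PowerSeries (Y n)) :=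
  (shiftedT n (k.val : ℂ)).submatrix (Fin.castLE k.isLt) (Fin.castLE k.isLt)

/-- For `k = m - 1`, the quasi-determinant `|T^{(m)}(u - m + 1)|_{mm}`. -/
def factor (n : ℕ) (k : Fin n) : PowerSeries (Y n) :=
  quasiDet (leadingT n k) (Fin.last k.val) (Fin.last k.val)

end

end Yangian

/-! Write D_k for qdet T^{(k)}(u), with D_0 = 1. The cofactors formed from A_k T_1(u) ⋯
T_{k-1}(u-k+2) make a row whose product with T^{(k)}(u-k+1) is D_k times the last basis row, and
whose last entry is D_{k-1}. Inverting the matrix gives D_{k-1} = D_k (T^{(k)}(u-k+1)^{-1})_{kk}, so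
the quasi-determinant is D_{k-1}^{-1} D_k (`qdet_submatrix_castSucc`, `factor_spec`). The product of
these telescopes to D_n, and they commute because the D_k do: D_l commutes with the entries of
T^{(l)}, out of which D_k is built for k ≤ l.

Existence of D_n and its centrality both come from one fusion identity (`fusion`). With R_{ab}(x) =
x - P_{ab}, the defining relations say R_{ab} T_a T_b = T_b T_a R_{ab}. Moving T_a(u+x) past
T_{b_1}(u) T_{b_2}(u-1) ⋯ produces a product of R-matrices, which the antisymmetrizer A over the b's
collapses to a nonzero multiple of A (x - ∑ P_{ab}). At x = 1 this is the antisymmetrizer with one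
more index, which proves by induction that A T_1 ⋯ T_m = T_m ⋯ T_1 A. This matrix is alternating on
both sides, hence a multiple of A (`eq_of_alternating`). With m + 1 copies of ℂ^m the larger
antisymmetrizer vanishes; then A ∑ P_{ab} = A, the collapsed factor is (x - 1) A, and for x ≠ 1 the
new T_a commutes with the determinant. A polynomial argument in the shift extends this to all
shifts. -/

namespace Yangian

open PowerSeries

/-! ### Substitution of a central series into a power series -/

section Evaluation

variable {R : Type*} [Ring R]

theorem coeff_mul_pow_eq_zero {w : PowerSeries R} (hw : X ∣ w) (f : PowerSeries R) {N r : ℕ}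
    (h : N < r) : coeff N (f * w ^ r) = 0 := by
  obtain ⟨v, rfl⟩ := hw
  rw [(commute_X v).symm.mul_pow, ← mul_assoc, ← (commute_X_pow f r).eq.symm, mul_assoc,
    coeff_X_pow_mul', if_neg (by omega)]

theorem coeff_mul_congr {f f' g g' : PowerSeries R} {N : ℕ}
    (hf : ∀ i ≤ N, coeff i f = coeff i f') (hg : ∀ i ≤ N, coeff i g = coeff i g') :
    coeff N (f * g) = coeff N (f' * g') := by
  rw [coeff_mul, coeff_mul]
  refine Finset.sum_congr rfl fun p hp => ?_
  have := Finset.HasAntidiagonal.mem_antidiagonal.1 hp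
  rw [hf _ (by omega), hg _ (by omega)]

/-- The value at `w` of the series `F`, whose coefficients are written on the left. It is meant for
`w` without constant term. -/
noncomputable def evalSeries (w : PowerSeries R) (F : PowerSeries (PowerSeries R)) :
    PowerSeries R :=
  mk fun N => coeff N (∑ r ∈ Finset.range (N + 1), coeff r F * w ^ r)

theorem coeff_evalSeries {w : PowerSeries R} (hw : X ∣ w) (F : PowerSeries (PowerSeries R))
    {N M : ℕ} (h : N < M) :
    coeff N (evalSeries w F) = coeff N (∑ r ∈ Finset.range M, coeff r F * w ^ r) := by
  rw [evalSeries, coeff_mk, map_sum, map_sum]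
  refine Finset.sum_subset (Finset.range_subset_range.2 h) fun r _ hr => ?_
  exact coeff_mul_pow_eq_zero hw _ (by simpa using hr)

theorem evalSeries_add (w : PowerSeries R) (F G : PowerSeries (PowerSeries R)) :
    evalSeries w (F + G) = evalSeries w F + evalSeries w G := by
  ext N
  simp only [evalSeries, coeff_mk, map_add, add_mul, Finset.sum_add_distrib]

theorem evalSeries_C {w : PowerSeries R} (hw : X ∣ w) (f : PowerSeries R) :
    evalSeries w (C f) = f := by
  ext N
  rw [coeff_evalSeries hw _ N.lt_succ_self, Finset.sum_range_succ']
  simp [coeff_C]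

theorem evalSeries_X {w : PowerSeries R} (hw : X ∣ w) : evalSeries w X = w := by
  ext N
  rw [coeff_evalSeries hw _ (show N < N + 2 by omega), Finset.sum_range_succ',
    Finset.sum_range_succ']
  simp [coeff_X]

theorem evalSeries_mul {w : PowerSeries R} (hw : X ∣ w) (hc : ∀ f, Commute w f)
    (F G : PowerSeries (PowerSeries R)) :
    evalSeries w (F * G) = evalSeries w F * evalSeries w G := by
  ext N
  rw [coeff_mul_congr (fun i hi => coeff_evalSeries hw F (Nat.lt_succ_of_le hi))
    (fun i hi => coeff_evalSeries hw G (Nat.lt_succ_of_le hi)),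
    coeff_evalSeries hw _ N.lt_succ_self]
  have key : ∀ r s, coeff r F * w ^ r * (coeff s G * w ^ s) =
      coeff r F * coeff s G * w ^ (r + s) := fun r s => by
    rw [mul_assoc, ← mul_assoc (w ^ r), ((hc (coeff s G)).pow_left r).eq, pow_add, mul_assoc,
      mul_assoc]
  rw [Finset.sum_mul_sum, ← Finset.sum_product', map_sum, map_sum]
  simp only [key, coeff_mul _ F G, Finset.sum_mul, map_sum]
  -- The square of pairs (r, s) is cut down to the triangle r + s ≤ N: outside it the factor w^(r+s)
  -- has order larger than N.
  rw [Finset.sum_sigma', ← Finset.sum_subset (s₁ := {p ∈ Finset.range (N + 1) ×ˢ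
    Finset.range (N + 1) | p.1 + p.2 ≤ N}) (Finset.filter_subset _ _)]
  · refine Finset.sum_bij' (fun q _ => q.2) (fun p _ => ⟨p.1 + p.2, p⟩) ?_ ?_ ?_ ?_ ?_
    · rintro ⟨k, p⟩ h
      simp only [Finset.mem_sigma, Finset.mem_range, Finset.mem_filter, Finset.mem_product,
        Finset.HasAntidiagonal.mem_antidiagonal] at h ⊢
      omega
    · rintro p h
      simp only [Finset.mem_sigma, Finset.mem_range, Finset.mem_filter, Finset.mem_product,
        Finset.HasAntidiagonal.mem_antidiagonal] at h ⊢
      exact ⟨by omega, trivial⟩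
    · rintro ⟨k, p⟩ h
      simp only [Finset.mem_sigma, Finset.HasAntidiagonal.mem_antidiagonal] at h
      obtain ⟨_, rfl⟩ := h
      rfl
    · intros; rfl
    · rintro ⟨k, p⟩ h
      simp only [Finset.mem_sigma, Finset.HasAntidiagonal.mem_antidiagonal] at h
      rw [h.2]
  · intro p hp hp'
    refine coeff_mul_pow_eq_zero hw _ ?_
    simp only [Finset.mem_filter, not_and, not_le] at hp'
    exact hp' hp

/-- Evaluation at a central series without constant term. -/
noncomputable def evalHom (w : PowerSeries R) (hw : X ∣ w) (hc : ∀ f, Commute w f) :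
    PowerSeries (PowerSeries R) →+* PowerSeries R where
  toFun := evalSeries w
  map_one' := by rw [← (C : PowerSeries R →+* _).map_one, evalSeries_C hw]
  map_mul' := evalSeries_mul hw hc
  map_zero' := by rw [← (C : PowerSeries R →+* _).map_zero, evalSeries_C hw]
  map_add' := evalSeries_add w

end Evaluation

/-! ### The shift u ↦ u - c as a ring homomorphism -/

section Shift

variable (A : Type*) [Ring A] [Algebra ℂ A]

/-- The series `(u - c)⁻¹` over `A`. -/
noncomputable def shiftedVarIn (c : ℂ) : PowerSeries A :=
  PowerSeries.map (algebraMap ℂ A) (shiftedVar c)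

theorem X_dvd_shiftedVarIn (c : ℂ) : X ∣ shiftedVarIn A c := by
  rw [shiftedVarIn, shiftedVar, map_mul, map_X]
  exact dvd_mul_right _ _

variable {A}

theorem map_algebraMap_commute (p : PowerSeries ℂ) (f : PowerSeries A) :
    Commute (PowerSeries.map (algebraMap ℂ A) p) f := by
  ext N
  rw [coeff_mul, coeff_mul, ← Finset.Nat.sum_antidiagonal_swap]
  refine Finset.sum_congr rfl fun q _ => ?_
  simp [Algebra.commutes]

theorem shift_eq_evalSeries (c : ℂ) (f : PowerSeries A) :
    shift c f = evalSeries (shiftedVarIn A c) (PowerSeries.map C f) := by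
  ext N
  simp only [shift, evalSeries, coeff_mk, map_sum, coeff_map, coeff_C_mul, shiftedVarIn, ← map_pow]
  refine Finset.sum_congr rfl fun r _ => ?_
  rw [Algebra.smul_def, Algebra.commutes]

/-- `shift c` as a ring homomorphism. -/
noncomputable def shiftHom (c : ℂ) : PowerSeries A →+* PowerSeries A :=
  (evalHom (shiftedVarIn A c) (X_dvd_shiftedVarIn A c)
    (map_algebraMap_commute (shiftedVar c))).comp (PowerSeries.map C)

theorem shiftHom_apply (c : ℂ) (f : PowerSeries A) : shiftHom c f = shift c f :=
  (shift_eq_evalSeries c f).symm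

theorem shift_X (c : ℂ) : shift c (X : PowerSeries A) = shiftedVarIn A c := by
  rw [shift_eq_evalSeries, map_X, evalSeries_X (X_dvd_shiftedVarIn A c)]

theorem shift_C (c : ℂ) (a : A) : shift c (C a) = C a := by
  rw [shift_eq_evalSeries, map_C, evalSeries_C (X_dvd_shiftedVarIn A c)]

theorem constantCoeff_shift (c : ℂ) (f : PowerSeries A) :
    constantCoeff (shift c f) = constantCoeff f := by
  rw [← coeff_zero_eq_constantCoeff_apply, shift, coeff_mk]
  simp

theorem shift_zero (f : PowerSeries A) : shift 0 f = f := by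
  have h : shiftedVar 0 = X := by simpa using shiftedVar_mul 0
  ext N
  rw [shift, coeff_mk, h, Finset.sum_range_succ, Finset.sum_eq_zero, zero_add]
  · simp [coeff_X_pow]
  · intro r hr
    have := Finset.mem_range.1 hr
    simp [coeff_X_pow, show N ≠ r by omega]

/-- Partial fractions, 1/(u-b) - 1/(u-a) = (b-a)/((u-a)(u-b)). This turns the relation in x⁻¹ and
y⁻¹ into one with the scalar factor x - y. -/
theorem shiftedVarIn_sub (a b : ℂ) :
    shiftedVarIn A b - shiftedVarIn A a = (b - a) • (shiftedVarIn A a * shiftedVarIn A b) := by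
  have h : shiftedVar b - shiftedVar a = C (b - a) * (shiftedVar a * shiftedVar b) := by
    have ha := shiftedVar_mul a
    have hb := shiftedVar_mul b
    have hX : (X : PowerSeries ℂ) ≠ 0 := X_ne_zero
    have h1 : (1 - C a * X : PowerSeries ℂ) ≠ 0 := fun h => by
      rw [h, mul_zero] at ha; exact hX ha.symm
    have h2 : (1 - C b * X : PowerSeries ℂ) ≠ 0 := fun h => by
      rw [h, mul_zero] at hb; exact hX hb.symm
    apply mul_right_cancel₀ (mul_ne_zero h1 h2)
    rw [map_sub]
    linear_combination (1 - C a * X) * hb - (1 - C b * X) * ha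
      - (C b - C a) * (shiftedVar b * (1 - C b * X)) * ha - (C b - C a) * X * hb
  rw [shiftedVarIn, shiftedVarIn, ← map_sub, h, map_mul, map_mul, map_C,
    ← PowerSeries.algebraMap_apply, Algebra.smul_def]

theorem isUnit_of_constantCoeff_eq_one {R : Type*} [Ring R] {f : PowerSeries R}
    (h : constantCoeff f = 1) : IsUnit f :=
  isUnit_iff_constantCoeff.2 (h ▸ isUnit_one)

theorem shiftedVarIn_mul_cancel (c : ℂ) {f g : PowerSeries A}
    (h : shiftedVarIn A c * f = shiftedVarIn A c * g) : f = g := by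
  rw [shiftedVarIn, shiftedVar, map_mul, map_X, mul_assoc, mul_assoc] at h
  have := X_mul_cancel h
  refine (IsUnit.mul_right_inj (isUnit_of_constantCoeff_eq_one ?_)).1 this
  rw [← coeff_zero_eq_constantCoeff_apply, coeff_map, coeff_mk, pow_zero, map_one]

end Shift


/-! ### The defining relations in generating-series form -/

section Relations

variable {A : Type*} [Ring A] [Algebra ℂ A]

/-- Matrices of series `S(u) = 1 + ⋯` satisfying the defining relations of the Yangian, in the form
`(x - y) [s_{ij}(x), s_{kl}(y)] = s_{kj}(x) s_{il}(y) - s_{kj}(y) s_{il}(x)` for `x = u - a` and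
`y = u - b`. -/
structure IsYangianMatrix {m : ℕ} (S : Matrix (Fin m) (Fin m) (PowerSeries A)) : Prop where
  constantCoeff_eq : ∀ i j, constantCoeff (S i j) = if i = j then 1 else 0
  shift_comm : ∀ (i j k l : Fin m) (a b : ℂ),
    (b - a) • (shift a (S i j) * shift b (S k l) - shift b (S k l) * shift a (S i j)) =
      shift a (S k j) * shift b (S i l) - shift b (S k j) * shift a (S i l)

theorem IsYangianMatrix.submatrix {m k : ℕ} {S : Matrix (Fin m) (Fin m) (PowerSeries A)}
    (hS : IsYangianMatrix S) {e : Fin k → Fin m} (he : Function.Injective e) :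
    IsYangianMatrix (S.submatrix e e) where
  constantCoeff_eq i j := by simp [hS.constantCoeff_eq, he.eq_iff]
  shift_comm i j k l a b := hS.shift_comm _ _ _ _ a b

theorem t_zero (n : ℕ) (i j : Fin n) : t n i j 0 = if i = j then 1 else 0 := by
  rw [t, freeT, apply_ite (RingQuot.mkAlgHom ℂ (Rel n)), map_one, map_zero]

theorem t_rel (n : ℕ) (i j k l : Fin n) (r s : ℕ) :
    t n i j (r + 1) * t n k l s - t n k l s * t n i j (r + 1) -
        (t n i j r * t n k l (s + 1) - t n k l (s + 1) * t n i j r) =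
      t n k j r * t n i l s - t n k j s * t n i l r := by
  have h := RingQuot.mkAlgHom_rel ℂ (Rel.defining i j k l r s)
  simp only [map_sub, map_mul] at h
  exact h

/-- The defining relations with s fixed, summed against u^(-r-1) over r. The missing constant term
holds because t^{(0)} is a scalar. -/
theorem T_rel_C (n : ℕ) (i j k l : Fin n) (s : ℕ) :
    T n i j * C (t n k l s) - C (t n k l s) * T n i j -
        X * (T n i j * C (t n k l (s + 1)) - C (t n k l (s + 1)) * T n i j) =
      X * (T n k j * C (t n i l s) - C (t n k j s) * T n i l) := by
  ext r
  cases r with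
  | zero =>
    simp only [map_sub, coeff_mul_C, coeff_C_mul, coeff_zero_X_mul, T, Matrix.of_apply, coeff_mk,
      t_zero]
    split_ifs <;> simp
  | succ r =>
    simp only [map_sub, coeff_mul_C, coeff_C_mul, coeff_succ_X_mul, T, Matrix.of_apply, coeff_mk]
    exact t_rel n i j k l r s

theorem isYangianMatrix_T (n : ℕ) : IsYangianMatrix (T n) where
  constantCoeff_eq i j := by
    rw [← coeff_zero_eq_constantCoeff_apply, T, Matrix.of_apply, coeff_mk, t_zero]
  shift_comm i j k l a b := by
    have h1 (s : ℕ) := congrArg (shiftHom a) (T_rel_C n i j k l s)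
    simp only [map_sub, map_mul, shiftHom_apply, shift_X, shift_C] at h1
    set wa := shiftedVarIn (Y n) a with hwa
    set wb := shiftedVarIn (Y n) b with hwb
    -- Summation over s: the outer variable `X` is y⁻¹, with coefficients that are already series in
    -- u⁻¹ after x = u - a. The identity reads (y⁻¹ - x⁻¹)[t_ij(x), t_kl(y)] = x⁻¹ y⁻¹ (⋯); next y⁻¹
    -- is replaced by (u-b)⁻¹.
    have h2 : X * (C (shift a (T n i j)) * PowerSeries.map C (T n k l) -
          PowerSeries.map C (T n k l) * C (shift a (T n i j))) -
        C wa * (C (shift a (T n i j)) * PowerSeries.map C (T n k l) -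
          PowerSeries.map C (T n k l) * C (shift a (T n i j))) =
        C wa * (X * (C (shift a (T n k j)) * PowerSeries.map C (T n i l) -
          PowerSeries.map C (T n k j) * C (shift a (T n i l)))) := by
      ext1 s
      cases s with
      | zero =>
        simp only [map_sub, coeff_mul_C, coeff_C_mul, coeff_zero_X_mul, T, Matrix.of_apply,
          coeff_mk, coeff_map, t_zero]
        split_ifs <;> simp
      | succ s =>
        have := h1 s
        simp only [map_sub, coeff_mul_C, coeff_C_mul, coeff_succ_X_mul, T, Matrix.of_apply,
          coeff_mk, coeff_map] at this ⊢
        exact this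
    have h3 := congrArg (evalHom wb (X_dvd_shiftedVarIn _ b)
      (map_algebraMap_commute (shiftedVar b))) h2
    simp only [map_sub, map_mul] at h3
    have e1 (f) : evalHom wb (X_dvd_shiftedVarIn _ b)
      (map_algebraMap_commute (shiftedVar b)) (C f) = f := evalSeries_C (X_dvd_shiftedVarIn _ b) f
    have e2 (f) : evalHom wb (X_dvd_shiftedVarIn _ b)
      (map_algebraMap_commute (shiftedVar b)) (PowerSeries.map C f) = shift b f :=
      shiftHom_apply b f
    have e3 : evalHom wb (X_dvd_shiftedVarIn _ b)
      (map_algebraMap_commute (shiftedVar b)) X = wb := evalSeries_X (X_dvd_shiftedVarIn _ b)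
    rw [e1, e1, e1, e1, e2, e2, e2, e3, ← sub_mul, hwa, hwb, shiftedVarIn_sub, smul_mul_assoc,
      ← mul_smul_comm, mul_assoc] at h3
    exact shiftedVarIn_mul_cancel b (shiftedVarIn_mul_cancel a h3)

theorem shift_polynomial (N r : ℕ) :
    ∃ q : Polynomial ℂ, ∀ c, coeff N (shiftedVar c ^ r) = q.eval c := by
  induction r generalizing N with
  | zero => exact ⟨Polynomial.C (coeff N 1), fun c => by rw [pow_zero, Polynomial.eval_C]⟩
  | succ r ih =>
    choose q hq using ih
    have h1 (M : ℕ) : ∃ q : Polynomial ℂ, ∀ c, coeff M (shiftedVar c) = q.eval c := by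
      cases M with
      | zero => exact ⟨0, fun c => by simp [shiftedVar]⟩
      | succ M => exact ⟨Polynomial.X ^ M, fun c => by
          rw [shiftedVar, coeff_succ_X_mul, coeff_mk]; simp⟩
    choose q' hq' using h1
    exact ⟨∑ p ∈ Finset.HasAntidiagonal.antidiagonal N, q p.1 * q' p.2, fun c => by
      simp only [pow_succ, coeff_mul, hq, hq', Polynomial.eval_finsetSum, Polynomial.eval_mul]⟩

/-- A series commuting with `f(u - c)` for infinitely many `c` commutes with it for all `c`. -/
theorem commute_shift_of_infinite (f D : PowerSeries A) {s : Set ℂ} (hs : s.Infinite)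
    (h : ∀ c ∈ s, Commute (shift c f) D) (c : ℂ) : Commute (shift c f) D := by
  rw [commute_iff_eq, ← sub_eq_zero]
  ext N
  -- Linear functionals reduce the claim to a scalar one: each coefficient of the commutator becomes
  -- a complex polynomial in c with infinitely many roots.
  rw [map_zero, ← Module.forall_dual_apply_eq_zero_iff ℂ]
  intro ℓ
  choose q hq using shift_polynomial
  let p : Polynomial ℂ := ∑ x ∈ Finset.HasAntidiagonal.antidiagonal N,
    ((∑ r ∈ Finset.range (x.1 + 1), Polynomial.C (ℓ (coeff r f * coeff x.2 D)) * q x.1 r) -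
     (∑ r ∈ Finset.range (x.1 + 1), Polynomial.C (ℓ (coeff x.2 D * coeff r f)) * q x.1 r))
  have hp (c : ℂ) : ℓ (coeff N (shift c f * D - D * shift c f)) = p.eval c := by
    rw [map_sub, coeff_mul, coeff_mul,
      ← Finset.Nat.sum_antidiagonal_swap (f := fun x => coeff x.1 D * coeff x.2 (shift c f))]
    simp only [p, shift, coeff_mk, Finset.sum_mul, Finset.mul_sum, Polynomial.eval_finsetSum,
      Polynomial.eval_sub, Polynomial.eval_mul, Polynomial.eval_C, ← hq, map_sub, map_sum,
      Prod.fst_swap, Prod.snd_swap, Finset.sum_sub_distrib, smul_mul_assoc, mul_smul_comm,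
      map_smul, smul_eq_mul, mul_comm]
  have hp0 : p = 0 := Polynomial.eq_zero_of_infinite_isRoot p <| hs.mono fun c hc => by
    rw [Set.mem_ofPred_eq, Polynomial.IsRoot, ← hp, (h c hc).eq, sub_self, map_zero, map_zero]
  rw [hp, hp0, Polynomial.eval_zero]

end Relations

open Equiv

/-! ### Antisymmetrizers and the fusion identity, for an abstract representation of permutations -/

section Fusion

variable {ι B : Type*} [DecidableEq ι] [Ring B] (ρ : Perm ι →* B)

/-- The sum of the transpositions `(a b)` over `b ∈ s`. -/
def starSum (a : ι) (s : Finset ι) : B := ∑ b ∈ s, ρ (swap a b)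

/-- The antisymmetrizer over the entries of a list. -/
def listAntisymmetrizer : List ι → B
  | [] => 1
  | a :: l => listAntisymmetrizer l * (1 - starSum ρ a l.toFinset)

variable {ρ}

theorem starSum_insert {a b : ι} {s : Finset ι} (hb : b ∉ s) :
    starSum ρ a (insert b s) = ρ (swap a b) + starSum ρ a s := by
  rw [starSum, Finset.sum_insert hb, starSum]

theorem commute_swap_starSum {a b c : ι} {s : Finset ι} (ha : a ∉ s) (hb : b ∈ s) (hc : c ∈ s) :
    Commute (ρ (swap b c)) (starSum ρ a s) := by
  have hab : a ≠ b := fun h => ha (h ▸ hb)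
  have hac : a ≠ c := fun h => ha (h ▸ hc)
  have hmem : ∀ d ∈ s, swap b c d ∈ s := fun d hd => by
    rw [swap_apply_def]; split_ifs <;> assumption
  rw [commute_iff_eq, starSum, Finset.mul_sum, Finset.sum_mul]
  refine Finset.sum_bij' (fun d _ => swap b c d) (fun d _ => swap b c d) hmem hmem
    (fun d _ => swap_apply_self b c d) (fun d _ => swap_apply_self b c d) fun d _ => ?_
  rw [← map_mul, ← map_mul, mul_swap_eq_swap_mul, swap_apply_of_ne_of_ne hab hac]

/-- Termwise (a c)(a b) = (c b)(a c), and y absorbs (c b) with a sign. -/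
theorem mul_starSum_mul_swap {y : B} {a b : ι} {s : Finset ι} (ha : a ∉ s) (hb : b ∉ s)
    (hab : a ≠ b) (h : ∀ c ∈ s, y * ρ (swap c b) = -y) :
    y * starSum ρ a s * ρ (swap a b) = -(y * starSum ρ a s) := by
  rw [starSum, Finset.mul_sum, Finset.sum_mul, ← Finset.sum_neg_distrib]
  refine Finset.sum_congr rfl fun c hc => ?_
  have hca : c ≠ a := fun e => ha (e ▸ hc)
  have hcb : c ≠ b := fun e => hb (e ▸ hc)
  rw [mul_assoc, ← map_mul, mul_swap_eq_swap_mul, swap_apply_left,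
    swap_apply_of_ne_of_ne hab.symm hcb.symm, map_mul, ← mul_assoc, h c hc, neg_mul]

theorem swap_mul_starSum_mul {y : B} {a b : ι} {s : Finset ι} (ha : a ∉ s) (hb : b ∉ s)
    (hab : a ≠ b) (h : ∀ c ∈ s, ρ (swap c b) * y = -y) :
    ρ (swap a b) * (starSum ρ a s * y) = -(starSum ρ a s * y) := by
  rw [starSum, Finset.sum_mul, Finset.mul_sum, ← Finset.sum_neg_distrib]
  refine Finset.sum_congr rfl fun c hc => ?_
  have hca : c ≠ a := fun e => ha (e ▸ hc)
  have hcb : c ≠ b := fun e => hb (e ▸ hc)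
  rw [← mul_assoc, ← map_mul, swap_mul_eq_mul_swap, swap_inv, swap_apply_left,
    swap_apply_of_ne_of_ne hab.symm hcb.symm, map_mul, mul_assoc, h c hc, mul_neg]

theorem commute_listAntisymmetrizer {y : B} {l : List ι}
    (h : ∀ b ∈ l, ∀ c ∈ l, b ≠ c → Commute y (ρ (swap b c))) (hl : l.Nodup) :
    Commute y (listAntisymmetrizer ρ l) := by
  induction l with
  | nil => exact Commute.one_right y
  | cons a l ih =>
    obtain ⟨ha, hl⟩ := List.nodup_cons.1 hl
    refine (ih (fun b hb c hc => h b (List.mem_cons_of_mem _ hb) c (List.mem_cons_of_mem _ hc))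
      hl).mul_right ((Commute.one_right y).sub_right (Commute.sum_right _ _ _ fun b hb => ?_))
    rw [List.mem_toFinset] at hb
    exact h a List.mem_cons_self b (List.mem_cons_of_mem _ hb) fun e => ha (e ▸ hb)

theorem commute_listAntisymmetrizer_starSum {a : ι} {l : List ι} (hl : (a :: l).Nodup) :
    Commute (starSum ρ a l.toFinset) (listAntisymmetrizer ρ l) := by
  obtain ⟨ha, hl⟩ := List.nodup_cons.1 hl
  exact commute_listAntisymmetrizer (fun b hb c hc _ => (commute_swap_starSum
    (by simpa using ha) (by simpa using hb) (by simpa using hc)).symm) hl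

/-- In A_l (1 - ∑ (a d)), right multiplication by (a c) exchanges the terms 1 and -(a c) up to sign,
and the remaining terms change sign by `mul_starSum_mul_swap`. A transposition inside l commutes
with the second factor and reaches A_l. -/
theorem listAntisymmetrizer_mul_swap {l : List ι} (hl : l.Nodup) {b c : ι} (hb : b ∈ l)
    (hc : c ∈ l) (hbc : b ≠ c) :
    listAntisymmetrizer ρ l * ρ (swap b c) = -listAntisymmetrizer ρ l := by
  induction l generalizing b c with
  | nil => simp at hb
  | cons a l ih =>
    obtain ⟨ha, hl⟩ := List.nodup_cons.1 hl
    have key : ∀ c ∈ l, listAntisymmetrizer ρ (a :: l) * ρ (swap a c) =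
        -listAntisymmetrizer ρ (a :: l) := fun c hc => by
      have hac : a ≠ c := fun e => ha (e ▸ hc)
      have hs := mul_starSum_mul_swap (ρ := ρ) (y := listAntisymmetrizer ρ l) (a := a) (b := c)
        (s := l.toFinset.erase c) (by simp [ha]) (by simp) hac fun d hd => by
          simp only [Finset.mem_erase, List.mem_toFinset] at hd
          exact ih hl hd.2 hc hd.1
      rw [listAntisymmetrizer, ← Finset.insert_erase (List.mem_toFinset.2 hc),
        starSum_insert (Finset.notMem_erase c _)]
      simp only [mul_sub, mul_add, sub_mul, add_mul, mul_one, hs]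
      rw [mul_assoc, ← map_mul, swap_mul_self, map_one, mul_one]
      abel
    rcases List.mem_cons.1 hb with rfl | hb'
    · exact key c ((List.mem_cons.1 hc).resolve_left hbc.symm)
    rcases List.mem_cons.1 hc with rfl | hc'
    · rw [swap_comm]; exact key b hb'
    have hcomm : Commute (ρ (swap b c)) (1 - starSum ρ a l.toFinset) :=
      (Commute.one_right _).sub_right
        (commute_swap_starSum (by simpa using ha) (by simpa using hb') (by simpa using hc'))
    rw [listAntisymmetrizer, mul_assoc, ← hcomm.eq, ← mul_assoc, ih hl hb' hc' hbc, neg_mul]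

theorem swap_mul_listAntisymmetrizer {l : List ι} (hl : l.Nodup) {b c : ι} (hb : b ∈ l)
    (hc : c ∈ l) (hbc : b ≠ c) :
    ρ (swap b c) * listAntisymmetrizer ρ l = -listAntisymmetrizer ρ l := by
  induction l generalizing b c with
  | nil => simp at hb
  | cons a l ih =>
    have hcm : listAntisymmetrizer ρ (a :: l) =
        (1 - starSum ρ a l.toFinset) * listAntisymmetrizer ρ l :=
      ((Commute.one_left _).sub_left (commute_listAntisymmetrizer_starSum hl)).eq.symm
    obtain ⟨ha, hl⟩ := List.nodup_cons.1 hl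
    have key : ∀ c ∈ l, ρ (swap a c) * listAntisymmetrizer ρ (a :: l) =
        -listAntisymmetrizer ρ (a :: l) := fun c hc => by
      have hac : a ≠ c := fun e => ha (e ▸ hc)
      have hs := swap_mul_starSum_mul (ρ := ρ) (y := listAntisymmetrizer ρ l) (a := a) (b := c)
        (s := l.toFinset.erase c) (by simp [ha]) (by simp) hac fun d hd => by
          simp only [Finset.mem_erase, List.mem_toFinset] at hd
          exact ih hl hd.2 hc hd.1
      rw [hcm, ← Finset.insert_erase (List.mem_toFinset.2 hc),
        starSum_insert (Finset.notMem_erase c _)]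
      simp only [mul_sub, mul_add, sub_mul, add_mul, one_mul, hs]
      rw [← mul_assoc, ← map_mul, swap_mul_self, map_one, one_mul]
      abel
    rcases List.mem_cons.1 hb with rfl | hb'
    · exact key c ((List.mem_cons.1 hc).resolve_left hbc.symm)
    rcases List.mem_cons.1 hc with rfl | hc'
    · rw [swap_comm]; exact key b hb'
    have hcomm : Commute (ρ (swap b c)) (1 - starSum ρ a l.toFinset) :=
      (Commute.one_right _).sub_right
        (commute_swap_starSum (by simpa using ha) (by simpa using hb') (by simpa using hc'))
    rw [hcm, ← mul_assoc, hcomm.eq, mul_assoc, ih hl hb' hc' hbc, mul_neg]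

variable (X : ℂ → ι → B)

/-- `X_{b_1}(u - d) X_{b_2}(u - d - 1) ⋯` over a list `b_1, b_2, …`. -/
def shiftedProd : List ι → ℂ → B
  | [], _ => 1
  | b :: l, d => X d b * shiftedProd l (d + 1)

/-- The product `shiftedProd` in the opposite order. -/
def shiftedProdRev : List ι → ℂ → B
  | [], _ => 1
  | b :: l, d => shiftedProdRev l (d + 1) * X d b

variable {X} (hX : ∀ (a b c : ι) (d : ℂ), c ≠ a → c ≠ b → Commute (ρ (swap a b)) (X d c))

include hX in
theorem commute_swap_shiftedProd {a b : ι} {l : List ι} (ha : a ∉ l) (hb : b ∉ l) (d : ℂ) :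
    Commute (ρ (swap a b)) (shiftedProd X l d) := by
  induction l generalizing d with
  | nil => exact Commute.one_right _
  | cons c l ih =>
    simp only [List.mem_cons, not_or] at ha hb
    exact (hX a b c d (Ne.symm ha.1) (Ne.symm hb.1)).mul_right (ih ha.2 hb.2 _)

include hX in
theorem commute_listAntisymmetrizer_of_notMem {a : ι} {l : List ι} (hl : (a :: l).Nodup) (d : ℂ) :
    Commute (listAntisymmetrizer ρ l) (X d a) := by
  obtain ⟨ha, hl⟩ := List.nodup_cons.1 hl
  exact (commute_listAntisymmetrizer (fun b hb c hc _ => (hX b c a d (fun e => ha (e ▸ hb))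
    (fun e => ha (e ▸ hc))).symm) hl).symm

variable [Algebra ℂ B]

variable (ρ) in
/-- The product `R_{a b_k}(x + k - 1) ⋯ R_{a b_1}(x)` of the `R`-matrices `R_{ab}(x) = x - P_{ab}`
over a list `b_1, …, b_k`. -/
def rProd (a : ι) : List ι → ℂ → B
  | [], _ => 1
  | b :: l, x => rProd a l (x + 1) * (x • 1 - ρ (swap a b))

/-- The antisymmetry of y makes the product of R-matrices linear in the transpositions. One step is
y (x + 1 - Σ)(x - P) = (x + 1) y (x - P - Σ), where yΣP = -yΣ. The condition on x keeps the scalars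
nonzero. -/
theorem mul_rProd {y : B} {a : ι} {l : List ι} (hl : (a :: l).Nodup)
    (h : ∀ b ∈ l, ∀ c ∈ l, b ≠ c → y * ρ (swap b c) = -y) (x : ℂ) (hx : ∀ i : ℕ, x + i ≠ 0) :
    ∃ q : ℂ, q ≠ 0 ∧ y * rProd ρ a l x = q • (y * (x • 1 - starSum ρ a l.toFinset)) := by
  induction l generalizing x with
  | nil =>
    have hx0 : x ≠ 0 := by simpa using hx 0
    -- The empty product is 1 while the right-hand side carries x, hence the scalar x⁻¹.
    exact ⟨x⁻¹, inv_ne_zero hx0, by simp [rProd, starSum, hx0]⟩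
  | cons b l ih =>
    simp only [List.nodup_cons, List.mem_cons, not_or] at hl
    obtain ⟨⟨hab, ha⟩, hb, hl⟩ := hl
    obtain ⟨q, hq, e⟩ := ih (List.nodup_cons.2 ⟨ha, hl⟩)
      (fun c hc d hd => h c (List.mem_cons_of_mem _ hc) d (List.mem_cons_of_mem _ hd)) (x + 1)
      fun i => by have := hx (i + 1); push_cast at this; rwa [add_assoc, add_comm 1]
    have hx1 : x + 1 ≠ 0 := by simpa using hx 1
    refine ⟨q * (x + 1), mul_ne_zero hq hx1, ?_⟩
    have hs := mul_starSum_mul_swap (ρ := ρ) (y := y) (a := a) (b := b) (s := l.toFinset)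
      (by simpa using ha) (by simpa using hb) hab fun c hc => by
        rw [List.mem_toFinset] at hc
        exact h c (List.mem_cons_of_mem _ hc) b List.mem_cons_self fun e => hb (e ▸ hc)
    rw [rProd, ← mul_assoc, e, List.toFinset_cons, starSum_insert (by simpa using hb)]
    simp only [mul_sub, mul_add, sub_mul, smul_mul_assoc, mul_smul_comm, mul_one, hs]
    module

variable (hR : ∀ (a b : ι) (d x : ℂ), a ≠ b →
    (x • 1 - ρ (swap a b)) * (X (d - x) a * X d b) = X d b * X (d - x) a * (x • 1 - ρ (swap a b)))

include hX in
theorem commute_rProd {a b : ι} {l : List ι} (ha : b ≠ a) (hb : b ∉ l) (d x : ℂ) :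
    Commute (rProd ρ a l x) (X d b) := by
  induction l generalizing x with
  | nil => exact Commute.one_left _
  | cons c l ih =>
    simp only [List.mem_cons, not_or] at hb
    exact (ih hb.2 _).mul_left
      (((Commute.one_left _).smul_left x).sub_left (hX a c b d ha hb.1))

-- The R-matrices are used one at a time to carry X_a to the right through the product; each
-- commutes with the X's on the other copies. The parameters shift together, so d - x stays fixed.
include hX hR in
theorem rProd_mul {a : ι} {l : List ι} (hl : (a :: l).Nodup) (d x : ℂ) :
    rProd ρ a l x * (X (d - x) a * shiftedProd X l d) =
      shiftedProd X l d * X (d - x) a * rProd ρ a l x := by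
  induction l generalizing d x with
  | nil => simp [rProd, shiftedProd]
  | cons b l ih =>
    simp only [List.nodup_cons, List.mem_cons, not_or] at hl
    obtain ⟨⟨hab, ha⟩, hb, hl⟩ := hl
    have e := ih (List.nodup_cons.2 ⟨ha, hl⟩) (d + 1) (x + 1)
    rw [show d + 1 - (x + 1) = d - x by ring] at e
    have h1 : Commute (x • 1 - ρ (swap a b)) (shiftedProd X l (d + 1)) :=
      ((Commute.one_left _).smul_left x).sub_left (commute_swap_shiftedProd hX ha hb _)
    calc rProd ρ a (b :: l) x * (X (d - x) a * shiftedProd X (b :: l) d)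
        = rProd ρ a l (x + 1) * ((x • 1 - ρ (swap a b)) * (X (d - x) a * X d b)) *
            shiftedProd X l (d + 1) := by simp only [rProd, shiftedProd, mul_assoc]
      _ = rProd ρ a l (x + 1) * X d b * X (d - x) a *
            ((x • 1 - ρ (swap a b)) * shiftedProd X l (d + 1)) := by
          rw [hR a b d x hab]; simp only [mul_assoc]
      _ = X d b * (rProd ρ a l (x + 1) * (X (d - x) a * shiftedProd X l (d + 1))) *
            (x • 1 - ρ (swap a b)) := by
          rw [h1.eq, (commute_rProd hX (Ne.symm hab) hb d _).eq]; simp only [mul_assoc]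
      _ = _ := by rw [e]; simp only [rProd, shiftedProd, mul_assoc]

-- A_l collapses the R-matrices of `rProd_mul` to x - ∑ (a b), by `mul_rProd`. The parameter x is
-- kept free: x = 1 gives the induction step for the antisymmetrized product, other values give
-- centrality.
include hX hR in
theorem fusion {a : ι} {l : List ι} (hl : (a :: l).Nodup) (d x : ℂ) (hx : ∀ i : ℕ, x + i ≠ 0)
    (h : listAntisymmetrizer ρ l * shiftedProd X l d =
      shiftedProdRev X l d * listAntisymmetrizer ρ l) :
    listAntisymmetrizer ρ l * (x • 1 - starSum ρ a l.toFinset) *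
        (X (d - x) a * shiftedProd X l d) =
      shiftedProdRev X l d * X (d - x) a *
        (listAntisymmetrizer ρ l * (x • 1 - starSum ρ a l.toFinset)) := by
  obtain ⟨q, hq, e⟩ := mul_rProd (ρ := ρ) hl (fun b hb c hc =>
    listAntisymmetrizer_mul_swap (List.nodup_cons.1 hl).2 hb hc) x hx
  have hA := (commute_listAntisymmetrizer_of_notMem hX hl (d - x)).eq
  apply smul_right_injective B hq
  simp only
  rw [← smul_mul_assoc, ← mul_smul_comm q (shiftedProdRev X l d * X (d - x) a), ← e,
    mul_assoc, rProd_mul hX hR hl]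
  simp only [← mul_assoc]
  rw [h, mul_assoc (shiftedProdRev X l d), hA]
  simp only [← mul_assoc]

include hX hR in
theorem listAntisymmetrizer_mul_shiftedProd {l : List ι} (hl : l.Nodup) (d : ℂ) :
    listAntisymmetrizer ρ l * shiftedProd X l d =
      shiftedProdRev X l d * listAntisymmetrizer ρ l := by
  induction l generalizing d with
  | nil => simp [shiftedProd, shiftedProdRev]
  | cons a l ih =>
    have hx : ∀ i : ℕ, (1 : ℂ) + i ≠ 0 := fun i => by
      rw [add_comm]; exact Nat.cast_add_one_ne_zero i
    have := fusion hX hR hl (d + 1) 1 hx (ih (List.nodup_cons.1 hl).2 _)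
    rw [add_sub_cancel_right, one_smul] at this
    exact this

include hX hR in
/-- If the antisymmetrizer over `a :: l` vanishes, `X_a` commutes with the antisymmetrized product
over `l`. -/
theorem commute_of_listAntisymmetrizer_eq_zero {a : ι} {l : List ι} (hl : (a :: l).Nodup) (d x : ℂ)
    (hx : ∀ i : ℕ, x + i ≠ 0) (hx1 : x ≠ 1) (h0 : listAntisymmetrizer ρ (a :: l) = 0) :
    Commute (X (d - x) a) (listAntisymmetrizer ρ l * shiftedProd X l d) := by
  have h := listAntisymmetrizer_mul_shiftedProd hX hR (List.nodup_cons.1 hl).2 d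
  have hf := fusion hX hR hl d x hx h
  have hA := (commute_listAntisymmetrizer_of_notMem hX hl (d - x)).eq
  rw [listAntisymmetrizer, mul_sub, mul_one, sub_eq_zero] at h0
  -- Vanishing of the larger antisymmetrizer means A_l ∑ (a b) = A_l.
  have e : listAntisymmetrizer ρ l * (x • 1 - starSum ρ a l.toFinset) =
      (x - 1) • listAntisymmetrizer ρ l := by
    rw [mul_sub, ← h0, mul_smul_comm, mul_one, sub_smul, one_smul]
  rw [e, smul_mul_assoc, mul_smul_comm] at hf
  have hf := smul_right_injective B (sub_ne_zero.2 hx1) hf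
  rw [commute_iff_eq, ← mul_assoc, ← hA, mul_assoc, hf, mul_assoc, ← hA, ← mul_assoc, h]

end Fusion

/-! ### Permutations and matrices acting on tensor powers -/

section PermMatrix

variable {R : Type*} [Ring R] {n N : ℕ}

theorem onCopy_mul_apply (X : Matrix (Fin n) (Fin n) R) (a : Fin N)
    (M : Matrix (Fin N → Fin n) (Fin N → Fin n) R) (I J : Fin N → Fin n) :
    (onCopy N X a * M) I J = ∑ k, X (I a) k * M (Function.update I a k) J := by
  rw [Matrix.mul_apply]
  symm
  refine Finset.sum_of_injOn (fun k => Function.update I a k)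
    ((Function.update_injective I a).injOn) (fun _ _ => Finset.mem_coe.2 (Finset.mem_univ _)) ?_ ?_
  · intro K _ hK
    rw [onCopy, Matrix.of_apply, if_neg, zero_mul]
    intro h
    refine hK ⟨K a, Finset.mem_coe.2 (Finset.mem_univ _), ?_⟩
    rw [Function.update_eq_iff]
    exact ⟨rfl, h⟩
  · intro k _
    rw [onCopy, Matrix.of_apply, if_pos, Function.update_self]
    intro b hb
    rw [Function.update_of_ne hb]

theorem mul_onCopy_apply (X : Matrix (Fin n) (Fin n) R) (a : Fin N)
    (M : Matrix (Fin N → Fin n) (Fin N → Fin n) R) (I J : Fin N → Fin n) :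
    (M * onCopy N X a) I J = ∑ k, M I (Function.update J a k) * X k (J a) := by
  rw [Matrix.mul_apply]
  symm
  refine Finset.sum_of_injOn (fun k => Function.update J a k)
    ((Function.update_injective J a).injOn) (fun _ _ => Finset.mem_coe.2 (Finset.mem_univ _)) ?_ ?_
  · intro K _ hK
    rw [onCopy, Matrix.of_apply, if_neg, mul_zero]
    intro h
    refine hK ⟨K a, Finset.mem_coe.2 (Finset.mem_univ _), ?_⟩
    rw [Function.update_eq_iff]
    exact ⟨rfl, fun b hb => (h b hb).symm⟩
  · intro k _
    rw [onCopy, Matrix.of_apply, if_pos, Function.update_self]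
    intro b hb
    rw [Function.update_of_ne hb]

theorem onCopy_mul_onCopy_apply (X Y : Matrix (Fin n) (Fin n) R) {a b : Fin N} (hab : a ≠ b)
    (I J : Fin N → Fin n) :
    (onCopy N X a * onCopy N Y b) I J =
      if ∀ c, c ≠ a → c ≠ b → I c = J c then X (I a) (J a) * Y (I b) (J b) else 0 := by
  rw [onCopy_mul_apply, Finset.sum_eq_single (J a)]
  · simp only [onCopy, Matrix.of_apply, Function.update_of_ne hab.symm, mul_ite, mul_zero]
    refine if_congr ⟨fun h c hca hcb => ?_, fun h c hcb => ?_⟩ rfl rfl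
    · rw [← h c hcb, Function.update_of_ne hca]
    · by_cases hca : c = a
      · rw [hca, Function.update_self]
      · rw [Function.update_of_ne hca, h c hca hcb]
  · intro k _ hk
    rw [onCopy, Matrix.of_apply, if_neg, mul_zero]
    intro h
    exact hk (by simpa using h a hab)
  · simp

variable (R n N)

/-- The action of permutations on `(ℂⁿ)^{⊗N}` by permuting the tensor factors. -/
def permHom : Perm (Fin N) →* Matrix (Fin N → Fin n) (Fin N → Fin n) R where
  toFun σ := Matrix.of fun I J => if I ∘ σ = J then 1 else 0
  map_one' := by ext I J; simp [Matrix.one_apply]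
  map_mul' σ τ := by
    ext I J
    simp only [Matrix.mul_apply, Matrix.of_apply, ite_mul, one_mul, zero_mul, Finset.sum_ite_eq,
      Finset.mem_univ, if_true]
    rfl

variable {R n N}

theorem permHom_apply (σ : Perm (Fin N)) (I J : Fin N → Fin n) :
    permHom R n N σ I J = if I ∘ σ = J then 1 else 0 := rfl

theorem permHom_mul_apply (σ : Perm (Fin N)) (M : Matrix (Fin N → Fin n) (Fin N → Fin n) R)
    (I J : Fin N → Fin n) : (permHom R n N σ * M) I J = M (I ∘ σ) J := by
  simp [Matrix.mul_apply, permHom_apply]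

theorem mul_permHom_apply (σ : Perm (Fin N)) (M : Matrix (Fin N → Fin n) (Fin N → Fin n) R)
    (I J : Fin N → Fin n) : (M * permHom R n N σ) I J = M I (J ∘ ⇑σ⁻¹) := by
  have h (K : Fin N → Fin n) : K ∘ σ = J ↔ K = J ∘ ⇑σ⁻¹ :=
    ⟨fun h => by rw [← h, Function.comp_assoc, ← Perm.coe_mul]; simp,
      fun h => by rw [h, Function.comp_assoc, ← Perm.coe_mul]; simp⟩
  simp [Matrix.mul_apply, permHom_apply, h]

theorem commute_permHom_onCopy (X : Matrix (Fin n) (Fin n) R) {a b c : Fin N} (hca : c ≠ a)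
    (hcb : c ≠ b) : Commute (permHom R n N (swap a b)) (onCopy N X c) := by
  ext I J
  rw [permHom_mul_apply, mul_permHom_apply, swap_inv, onCopy, Matrix.of_apply, Matrix.of_apply,
    Function.comp_apply, Function.comp_apply, swap_apply_of_ne_of_ne hca hcb]
  refine if_congr ⟨fun h d hd => ?_, fun h d hd => ?_⟩ rfl rfl
  · have hd' : swap a b d ≠ c := fun e => hd (by
      rw [← swap_apply_self a b d, e, swap_apply_of_ne_of_ne hca hcb])
    simpa using h _ hd'
  · have hd' : swap a b d ≠ c := fun e => hd (by
      rw [← swap_apply_self a b d, e, swap_apply_of_ne_of_ne hca hcb])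
    simpa using h _ hd'

/-- Entrywise, P_{ab} swaps the two row or column indices at a and b, so each entry is the scalar
relation `h` or 0 = 0. -/
theorem rtt [Algebra ℂ R] {X Y : Matrix (Fin n) (Fin n) R} {x : ℂ}
    (h : ∀ i j k l, x • (X i j * Y k l - Y k l * X i j) = X k j * Y i l - Y k j * X i l)
    {a b : Fin N} (hab : a ≠ b) :
    (x • 1 - permHom R n N (swap a b)) * (onCopy N X a * onCopy N Y b) =
      onCopy N Y b * onCopy N X a * (x • 1 - permHom R n N (swap a b)) := by
  ext I J
  simp only [sub_mul, mul_sub, smul_mul_assoc, mul_smul_comm, one_mul, mul_one, Matrix.sub_apply,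
    Matrix.smul_apply]
  rw [permHom_mul_apply, mul_permHom_apply, swap_inv, onCopy_mul_onCopy_apply _ _ hab,
    onCopy_mul_onCopy_apply _ _ hab.symm, onCopy_mul_onCopy_apply _ _ hab,
    onCopy_mul_onCopy_apply _ _ hab.symm]
  have e1 : (∀ c, c ≠ a → c ≠ b → (I ∘ swap a b) c = J c) ↔ ∀ c, c ≠ a → c ≠ b → I c = J c :=
    forall_congr' fun c => forall₂_congr fun ha hb => by
      rw [Function.comp_apply, swap_apply_of_ne_of_ne ha hb]
  have e2 : (∀ c, c ≠ b → c ≠ a → I c = J c) ↔ ∀ c, c ≠ a → c ≠ b → I c = J c :=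
    forall_congr' fun c => forall_comm
  have e3 : (∀ c, c ≠ b → c ≠ a → I c = (J ∘ swap a b) c) ↔ ∀ c, c ≠ a → c ≠ b → I c = J c := by
    rw [← e2]
    exact forall_congr' fun c => forall₂_congr fun hb ha => by
      rw [Function.comp_apply, swap_apply_of_ne_of_ne ha hb]
  simp only [e1, e2, e3]
  simp only [Function.comp_apply, swap_apply_left, swap_apply_right]
  split_ifs
  · have := h (I a) (J a) (I b) (J b)
    rw [smul_sub, sub_eq_sub_iff_add_eq_add] at this
    rw [sub_eq_sub_iff_add_eq_add, this, add_comm]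
  · simp

end PermMatrix

/-! ### Alternating matrices -/

section Alternating

variable {R : Type*} [Ring R] [Algebra ℂ R] {n N : ℕ}

theorem eq_zero_of_eq_neg {V : Type*} [AddCommGroup V] [Module ℂ V] {x : V} (h : x = -x) :
    x = 0 := by
  have : (2 : ℂ) • x = 0 := by rw [two_smul]; nth_rewrite 2 [h]; exact add_neg_cancel x
  simpa using this

theorem apply_eq_zero_of_not_injective {M : Matrix (Fin N → Fin n) (Fin N → Fin n) R}
    (h : ∀ b c, b ≠ c → permHom R n N (swap b c) * M = -M) {I : Fin N → Fin n}
    (hI : ¬ Function.Injective I) (J : Fin N → Fin n) : M I J = 0 := by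
  obtain ⟨b, c, hbc, hne⟩ : ∃ b c, I b = I c ∧ b ≠ c := by
    simpa [Function.Injective] using hI
  have hIs : I ∘ swap b c = I := by
    funext d
    rw [Function.comp_apply, swap_apply_def]
    split_ifs with h1 h2
    · rw [h1, hbc]
    · rw [h2, hbc]
    · rfl
  have e := congrFun (congrFun (h b c hne) I) J
  rw [permHom_mul_apply, hIs] at e
  exact eq_zero_of_eq_neg e

theorem apply_eq_zero_of_not_injective_right {M : Matrix (Fin N → Fin n) (Fin N → Fin n) R}
    (h : ∀ b c, b ≠ c → M * permHom R n N (swap b c) = -M) (I : Fin N → Fin n) {J : Fin N → Fin n}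
    (hJ : ¬ Function.Injective J) : M I J = 0 := by
  obtain ⟨b, c, hbc, hne⟩ : ∃ b c, J b = J c ∧ b ≠ c := by
    simpa [Function.Injective] using hJ
  have hJs : J ∘ swap b c = J := by
    funext d
    rw [Function.comp_apply, swap_apply_def]
    split_ifs with h1 h2
    · rw [h1, hbc]
    · rw [h2, hbc]
    · rfl
  have e := congrFun (congrFun (h b c hne) I) J
  rw [mul_permHom_apply, swap_inv, hJs] at e
  exact eq_zero_of_eq_neg e

omit [Algebra ℂ R] in
theorem apply_comp_perm_eq_zero {M : Matrix (Fin N → Fin n) (Fin N → Fin n) R}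
    (h : ∀ b c, b ≠ c → permHom R n N (swap b c) * M = -M) {I J : Fin N → Fin n} (h0 : M I J = 0)
    (σ : Perm (Fin N)) : M (I ∘ σ) J = 0 := by
  rw [← permHom_mul_apply σ M I J]
  induction σ using Perm.swap_induction_on' with
  | one => simpa using h0
  | mul_swap f b c hbc ih => rw [map_mul, mul_assoc, h b c hbc, mul_neg, Matrix.neg_apply, ih,
      neg_zero]

omit [Algebra ℂ R] in
theorem apply_comp_perm_eq_zero_right {M : Matrix (Fin N → Fin n) (Fin N → Fin n) R}
    (h : ∀ b c, b ≠ c → M * permHom R n N (swap b c) = -M) {I J : Fin N → Fin n} (h0 : M I J = 0)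
    (σ : Perm (Fin N)) : M I (J ∘ σ) = 0 := by
  rw [← inv_inv σ, ← mul_permHom_apply σ⁻¹ M I J]
  induction σ⁻¹ using Perm.swap_induction_on with
  | one => simpa using h0
  | swap_mul f b c hbc ih => rw [map_mul, ← mul_assoc, h b c hbc, neg_mul, Matrix.neg_apply, ih,
      neg_zero]

/-- A matrix on `(ℂᵐ)^{⊗m}` that is alternating on both sides is determined by one entry. -/
theorem eq_of_alternating {m : ℕ} {M M' : Matrix (Fin m → Fin m) (Fin m → Fin m) R}
    (hl : ∀ b c, b ≠ c → permHom R m m (swap b c) * M = -M)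
    (hr : ∀ b c, b ≠ c → M * permHom R m m (swap b c) = -M)
    (hl' : ∀ b c, b ≠ c → permHom R m m (swap b c) * M' = -M')
    (hr' : ∀ b c, b ≠ c → M' * permHom R m m (swap b c) = -M')
    (h : M id id = M' id id) : M = M' := by
  rw [← sub_eq_zero]
  have hL : ∀ b c, b ≠ c → permHom R m m (swap b c) * (M - M') = -(M - M') := fun b c hbc => by
    rw [mul_sub, hl b c hbc, hl' b c hbc]; abel
  have hR : ∀ b c, b ≠ c → (M - M') * permHom R m m (swap b c) = -(M - M') := fun b c hbc => by
    rw [sub_mul, hr b c hbc, hr' b c hbc]; abel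
  ext I J
  rw [Matrix.zero_apply]
  by_cases hI : Function.Injective I
  swap
  · exact apply_eq_zero_of_not_injective hL hI J
  by_cases hJ : Function.Injective J
  swap
  · exact apply_eq_zero_of_not_injective_right hR I hJ
  -- An injective multi-index `Fin m → Fin m` is a permutation of `id`, so its entry is reached from
  -- the one at (`id`, `id`).
  exact apply_comp_perm_eq_zero hL (I := id) (apply_comp_perm_eq_zero_right hR (J := id)
    (sub_eq_zero.2 h) (Equiv.ofBijective J hJ.bijective_of_finite))
    (Equiv.ofBijective I hI.bijective_of_finite)

end Alternating

/-! ### Adding a tensor factor -/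

section AddCopy

variable {R : Type*} [Ring R] {n m : ℕ}

variable (R n m) in
/-- The embedding `M ↦ 1 ⊗ M` adding a tensor factor in front. -/
def addCopy : Matrix (Fin m → Fin n) (Fin m → Fin n) R →+*
    Matrix (Fin (m + 1) → Fin n) (Fin (m + 1) → Fin n) R where
  toFun M := Matrix.of fun I J => if I 0 = J 0 then M (Fin.tail I) (Fin.tail J) else 0
  map_one' := by
    ext I J
    rw [Matrix.of_apply, Matrix.one_apply, Matrix.one_apply, ← ite_and]
    refine if_congr ⟨fun h => ?_, fun h => h ▸ ⟨rfl, rfl⟩⟩ rfl rfl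
    rw [← Fin.cons_self_tail I, ← Fin.cons_self_tail J, h.1, h.2]
  map_zero' := by ext I J; simp
  map_add' M M' := by
    ext I J
    simp only [Matrix.of_apply, Matrix.add_apply]
    split_ifs <;> simp
  map_mul' M M' := by
    ext I J
    rw [Matrix.mul_apply, ← (Fin.consEquiv fun _ => Fin n).sum_comp, Fintype.sum_prod_type]
    simp only [Fin.consEquiv_apply, Matrix.of_apply, Fin.cons_zero, ite_mul,
      zero_mul]
    rw [Finset.sum_eq_single (I 0) (fun k _ hk => by simp [hk.symm]) (by simp)]
    simp only [if_true, mul_ite, mul_zero]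
    split_ifs
    · rw [Matrix.mul_apply]
      rfl
    · simp

theorem addCopy_apply (M : Matrix (Fin m → Fin n) (Fin m → Fin n) R) (I J : Fin (m + 1) → Fin n) :
    addCopy R n m M I J = if I 0 = J 0 then M (Fin.tail I) (Fin.tail J) else 0 := rfl

theorem addCopy_swap (b c : Fin m) :
    addCopy R n m (permHom R n m (swap b c)) = permHom R n (m + 1) (swap b.succ c.succ) := by
  ext I J
  rw [addCopy_apply, permHom_apply, permHom_apply, ← ite_and]
  refine if_congr ?_ rfl rfl
  rw [funext_iff, funext_iff, Fin.forall_fin_succ]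
  simp only [Function.comp_apply, ← (Fin.succ_injective m).map_swap, Fin.tail]
  rw [swap_apply_of_ne_of_ne (Fin.succ_ne_zero b).symm (Fin.succ_ne_zero c).symm]

theorem addCopy_onCopy (X : Matrix (Fin n) (Fin n) R) (a : Fin m) :
    addCopy R n m (onCopy m X a) = onCopy (m + 1) X a.succ := by
  ext I J
  rw [addCopy_apply, onCopy, onCopy, Matrix.of_apply, Matrix.of_apply, ← ite_and]
  refine if_congr ?_ rfl rfl
  rw [Fin.forall_fin_succ]
  simp [Fin.tail, (Fin.succ_ne_zero a).symm]

theorem addCopy_listAntisymmetrizer (l : List (Fin m)) :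
    addCopy R n m (listAntisymmetrizer (permHom R n m) l) =
      listAntisymmetrizer (permHom R n (m + 1)) (l.map Fin.succ) := by
  induction l with
  | nil => exact map_one _
  | cons a l ih =>
    have hs : (l.map Fin.succ).toFinset = l.toFinset.image Fin.succ := by ext; simp
    rw [listAntisymmetrizer, map_mul, ih, List.map_cons, listAntisymmetrizer, map_sub, map_one,
      starSum, starSum, map_sum, hs,
      Finset.sum_image (Fin.succ_injective m).injOn]
    simp only [addCopy_swap]

end AddCopy

/-! ### The quantum determinant and its centrality -/

section QuantumDeterminant

variable {A : Type*} [Ring A] [Algebra ℂ A] {n m N : ℕ}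

/-- The matrices `S_a(u - c)`. -/
noncomputable def copies (N : ℕ) (S : Matrix (Fin n) (Fin n) (PowerSeries A)) (c : ℂ) (a : Fin N) :
    Matrix (Fin N → Fin n) (Fin N → Fin n) (PowerSeries A) :=
  onCopy N (S.map (shift c)) a

theorem commute_swap_copies (S : Matrix (Fin n) (Fin n) (PowerSeries A)) (a b c : Fin N) (d : ℂ)
    (hca : c ≠ a) (hcb : c ≠ b) :
    Commute (permHom (PowerSeries A) n N (swap a b)) (copies N S d c) :=
  commute_permHom_onCopy _ hca hcb

theorem IsYangianMatrix.rtt {S : Matrix (Fin n) (Fin n) (PowerSeries A)} (hS : IsYangianMatrix S)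
    (a b : Fin N) (d x : ℂ) (hab : a ≠ b) :
    (x • 1 - permHom (PowerSeries A) n N (swap a b)) * (copies N S (d - x) a * copies N S d b) =
      copies N S d b * copies N S (d - x) a *
        (x • 1 - permHom (PowerSeries A) n N (swap a b)) := by
  refine Yangian.rtt (fun i j k l => ?_) hab
  have := hS.shift_comm i j k l (d - x) d
  rw [sub_sub_cancel] at this
  exact this

theorem addCopy_shiftedProd (S : Matrix (Fin n) (Fin n) (PowerSeries A)) (l : List (Fin m))
    (d : ℂ) : addCopy (PowerSeries A) n m (shiftedProd (copies m S) l d) =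
      shiftedProd (copies (m + 1) S) (l.map Fin.succ) d := by
  induction l generalizing d with
  | nil => exact map_one _
  | cons a l ih =>
    rw [shiftedProd, map_mul, ih, List.map_cons, shiftedProd, copies, addCopy_onCopy, copies]

theorem antisymmetrizer_eq_sum (R : Type*) [Ring R] (n m : ℕ) :
    antisymmetrizer R n m = ∑ σ : Perm (Fin m), (Perm.sign σ : ℤ) • permHom R n m σ := by
  ext I J
  rw [antisymmetrizer, Matrix.of_apply, ← Equiv.sum_comp (Equiv.inv (Perm (Fin m))),
    Matrix.sum_apply]
  refine Finset.sum_congr rfl fun σ _ => ?_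
  simp [permHom_apply, Equiv.eq_comp_symm]

theorem swap_mul_antisymmetrizer (R : Type*) [Ring R] (n m : ℕ) {b c : Fin m} (h : b ≠ c) :
    permHom R n m (swap b c) * antisymmetrizer R n m = -antisymmetrizer R n m := by
  rw [antisymmetrizer_eq_sum, Finset.mul_sum, ← Finset.sum_neg_distrib,
    ← Equiv.sum_comp (Equiv.mulLeft (swap b c))]
  refine Finset.sum_congr rfl fun σ _ => ?_
  rw [Equiv.coe_mulLeft, Perm.sign_mul, Perm.sign_swap h, mul_smul_comm, ← map_mul, ← mul_assoc,
    swap_mul_self, one_mul]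
  simp

theorem antisymmetrizer_mul_swap (R : Type*) [Ring R] (n m : ℕ) {b c : Fin m} (h : b ≠ c) :
    antisymmetrizer R n m * permHom R n m (swap b c) = -antisymmetrizer R n m := by
  rw [antisymmetrizer_eq_sum, Finset.sum_mul, ← Finset.sum_neg_distrib,
    ← Equiv.sum_comp (Equiv.mulRight (swap b c))]
  refine Finset.sum_congr rfl fun σ _ => ?_
  rw [Equiv.coe_mulRight, Perm.sign_mul, Perm.sign_swap h, smul_mul_assoc, ← map_mul, mul_assoc,
    swap_mul_self, mul_one]
  simp

theorem antisymmetrizer_id (R : Type*) [Ring R] (m : ℕ) : antisymmetrizer R m m id id = 1 := by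
  rw [antisymmetrizer, Matrix.of_apply, Finset.sum_eq_single 1]
  · simp
  · intro σ _ hσ
    rw [if_neg]
    intro h
    exact hσ (Equiv.ext fun i => (congrFun h i).symm)
  · simp

theorem listAntisymmetrizer_apply_eq_zero {R : Type*} [Ring R] {l : List (Fin N)} {a : Fin N}
    (ha : a ∉ l) {I J : Fin N → Fin n} (h : I a ≠ J a) :
    listAntisymmetrizer (permHom R n N) l I J = 0 := by
  induction l generalizing J with
  | nil => exact Matrix.one_apply_ne fun e => h (e ▸ rfl)
  | cons b l ih =>
    simp only [List.mem_cons, not_or] at ha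
    rw [listAntisymmetrizer, mul_sub, mul_one, Matrix.sub_apply, ih ha.2 h, zero_sub, starSum,
      Finset.mul_sum, Matrix.sum_apply, neg_eq_zero]
    refine Finset.sum_eq_zero fun c hc => ?_
    rw [mul_permHom_apply, swap_inv]
    refine ih ha.2 ?_
    rw [Function.comp_apply, swap_apply_of_ne_of_ne ha.1 fun e => ha.2 (e ▸ List.mem_toFinset.1 hc)]
    exact h

theorem listAntisymmetrizer_id {R : Type*} [Ring R] {l : List (Fin m)} (hl : l.Nodup) :
    listAntisymmetrizer (permHom R m m) l id id = 1 := by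
  induction l with
  | nil => exact Matrix.one_apply_eq _
  | cons a l ih =>
    obtain ⟨ha, hl⟩ := List.nodup_cons.1 hl
    rw [listAntisymmetrizer, mul_sub, mul_one, Matrix.sub_apply, ih hl, starSum, Finset.mul_sum,
      Matrix.sum_apply, sub_eq_self]
    refine Finset.sum_eq_zero fun c hc => ?_
    rw [mul_permHom_apply, swap_inv]
    refine listAntisymmetrizer_apply_eq_zero ha ?_
    rw [Function.comp_apply, swap_apply_left]
    exact fun e => ha (by rw [id, id] at e; exact e ▸ List.mem_toFinset.1 hc)

/-- Both sides are alternating on the left and on the right with entry 1 at (`id`, `id`), so no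
coset decomposition of the permutation sum is needed. -/
theorem antisymmetrizer_eq_listAntisymmetrizer (R : Type*) [Ring R] [Algebra ℂ R] (m : ℕ) :
    antisymmetrizer R m m = listAntisymmetrizer (permHom R m m) (List.finRange m) :=
  eq_of_alternating (fun _ _ => swap_mul_antisymmetrizer R m m)
    (fun _ _ => antisymmetrizer_mul_swap R m m)
    (fun b c => swap_mul_listAntisymmetrizer (List.nodup_finRange m) (List.mem_finRange b)
      (List.mem_finRange c))
    (fun b c => listAntisymmetrizer_mul_swap (List.nodup_finRange m) (List.mem_finRange b)
      (List.mem_finRange c))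
    ((antisymmetrizer_id R m).trans (listAntisymmetrizer_id (List.nodup_finRange m)).symm)

/-- The product `S_1(u) S_2(u - 1) ⋯ S_m(u - m + 1)`. -/
noncomputable def copiesProd (S : Matrix (Fin m) (Fin m) (PowerSeries A)) :
    Matrix (Fin m → Fin m) (Fin m → Fin m) (PowerSeries A) :=
  shiftedProd (copies m S) (List.finRange m) 0

/-- The quantum determinant of `S(u)`. -/
noncomputable def qdet (S : Matrix (Fin m) (Fin m) (PowerSeries A)) : PowerSeries A :=
  (antisymmetrizer (PowerSeries A) m m * copiesProd S) id id

variable {S : Matrix (Fin m) (Fin m) (PowerSeries A)}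

theorem IsYangianMatrix.antisymmetrizer_mul_copiesProd (hS : IsYangianMatrix S) :
    antisymmetrizer (PowerSeries A) m m * copiesProd S =
      shiftedProdRev (copies m S) (List.finRange m) 0 * antisymmetrizer (PowerSeries A) m m := by
  rw [antisymmetrizer_eq_listAntisymmetrizer]
  exact listAntisymmetrizer_mul_shiftedProd (commute_swap_copies S) hS.rtt
    (List.nodup_finRange m) 0

theorem IsYangianMatrix.antisymmetrizer_mul_copiesProd_mul_swap (hS : IsYangianMatrix S)
    {b c : Fin m} (h : b ≠ c) :
    antisymmetrizer (PowerSeries A) m m * copiesProd S * permHom (PowerSeries A) m m (swap b c) =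
      -(antisymmetrizer (PowerSeries A) m m * copiesProd S) := by
  rw [hS.antisymmetrizer_mul_copiesProd, mul_assoc, antisymmetrizer_mul_swap _ _ _ h, mul_neg]

theorem antisymmetrizer_mul_scalar_id (R : Type*) [Ring R] (m : ℕ) (D : R) :
    (antisymmetrizer R m m * Matrix.scalar (Fin m → Fin m) D) id id = D := by
  rw [Matrix.scalar_apply, Matrix.mul_diagonal, antisymmetrizer_id, one_mul]

theorem permHom_commute_scalar (R : Type*) [Ring R] (n m : ℕ) (D : R) (σ : Perm (Fin m)) :
    Commute (permHom R n m σ) (Matrix.scalar (Fin m → Fin n) D) := by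
  ext I J
  rw [Matrix.scalar_apply, Matrix.mul_diagonal, Matrix.diagonal_mul, permHom_apply]
  split_ifs <;> simp

theorem IsYangianMatrix.antisymmetrizer_mul_copiesProd_eq (hS : IsYangianMatrix S) :
    antisymmetrizer (PowerSeries A) m m * copiesProd S =
      antisymmetrizer (PowerSeries A) m m * Matrix.scalar (Fin m → Fin m) (qdet S) :=
  eq_of_alternating
    (fun b c h => by rw [← mul_assoc, swap_mul_antisymmetrizer _ _ _ h, neg_mul])
    (fun b c h => hS.antisymmetrizer_mul_copiesProd_mul_swap h)
    (fun b c h => by rw [← mul_assoc, swap_mul_antisymmetrizer _ _ _ h, neg_mul])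
    (fun b c h => by
      rw [mul_assoc, ← (permHom_commute_scalar _ _ _ _ _).eq, ← mul_assoc,
        antisymmetrizer_mul_swap _ _ _ h, neg_mul])
    (antisymmetrizer_mul_scalar_id _ _ _).symm

/-- The coefficients of the quantum determinant commute with those of `S(u)`. -/
theorem IsYangianMatrix.commute_shift_qdet (hS : IsYangianMatrix S) (i j : Fin m) (c : ℂ) :
    Commute (shift c (S i j)) (qdet S) := by
  -- The shifts are -x with x = k + 2, which avoids x = 1 and the zeros of x + i in the fusion
  -- argument.
  have hinf : (Set.range fun k : ℕ => -((k : ℂ) + 2)).Infinite :=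
    Set.infinite_range_of_injective fun k l h => by simpa using h
  refine commute_shift_of_infinite _ _ hinf ?_ c
  rintro _ ⟨k, rfl⟩
  have hl : ((0 : Fin (m + 1)) :: (List.finRange m).map Fin.succ).Nodup := by
    rw [← List.finRange_succ]
    exact List.nodup_finRange _
  -- No map from m + 1 indices to m values is injective.
  have h0 : listAntisymmetrizer (permHom (PowerSeries A) m (m + 1))
      (0 :: (List.finRange m).map Fin.succ) = 0 := by
    have hmem (b : Fin (m + 1)) : b ∈ (0 : Fin (m + 1)) :: (List.finRange m).map Fin.succ := by
      rw [← List.finRange_succ]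
      exact List.mem_finRange b
    ext I J
    refine congrArg _ (apply_eq_zero_of_not_injective (fun b c => swap_mul_listAntisymmetrizer hl
      (hmem b) (hmem c)) (fun h => ?_) J)
    simpa using Fintype.card_le_of_injective I h
  have hc := commute_of_listAntisymmetrizer_eq_zero (commute_swap_copies S) hS.rtt hl 0
    ((k : ℂ) + 2) (fun i => by
      have : ((k + 2 + i : ℕ) : ℂ) ≠ 0 := Nat.cast_ne_zero.2 (by omega)
      push_cast at this; exact this)
    (fun h => by
      have : ((k + 2 : ℕ) : ℂ) = (1 : ℕ) := by push_cast; exact h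
      have := Nat.cast_injective this
      omega) h0
  rw [← addCopy_listAntisymmetrizer, ← addCopy_shiftedProd, ← map_mul,
    ← antisymmetrizer_eq_listAntisymmetrizer, zero_sub] at hc
  -- The new copy selects the entry (i, j) of S, the other m copies select the determinant.
  have e := congrFun (congrFun hc.eq (Fin.cons i id)) (Fin.cons j id)
  rw [copies, onCopy_mul_apply, mul_onCopy_apply] at e
  simp only [addCopy_apply, Fin.update_cons_zero, Fin.cons_zero, Fin.tail_cons, Matrix.map_apply,
    mul_ite, ite_mul, mul_zero, zero_mul, Finset.sum_ite_eq, Finset.sum_ite_eq', Finset.mem_univ,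
    if_true] at e
  exact e

end QuantumDeterminant

/-! ### Formal properties of shifted products -/

section ShiftedProd

variable {ι κ B : Type*} [Ring B]

theorem shiftedProd_ofFn {k : ℕ} (X : ℂ → ι → B) (f : Fin k → ι) (d : ℂ) :
    shiftedProd X (List.ofFn f) d = (List.ofFn fun a : Fin k => X (d + a.val) (f a)).prod := by
  induction k generalizing d with
  | zero => simp [shiftedProd]
  | succ k ih =>
    rw [List.ofFn_succ, List.ofFn_succ, List.prod_cons, shiftedProd, ih]
    simp [add_assoc, add_comm (1 : ℂ)]

theorem shiftedProdRev_ofFn {k : ℕ} (X : ℂ → ι → B) (f : Fin k → ι) (d : ℂ) :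
    shiftedProdRev X (List.ofFn f) d =
      (List.ofFn fun a : Fin k => X (d + a.val) (f a)).reverse.prod := by
  induction k generalizing d with
  | zero => simp [shiftedProdRev]
  | succ k ih =>
    rw [List.ofFn_succ, List.ofFn_succ, List.reverse_cons, List.prod_append, shiftedProdRev, ih]
    simp [add_assoc, add_comm (1 : ℂ)]

theorem shiftedProd_append (X : ℂ → ι → B) (l l' : List ι) (d : ℂ) :
    shiftedProd X (l ++ l') d = shiftedProd X l d * shiftedProd X l' (d + l.length) := by
  induction l generalizing d with
  | nil => simp [shiftedProd]
  | cons a l ih =>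
    rw [List.cons_append, shiftedProd, ih, shiftedProd, mul_assoc, List.length_cons]
    push_cast
    rw [add_assoc, add_comm (1 : ℂ)]

theorem shiftedProd_map (X : ℂ → ι → B) (f : κ → ι) (l : List κ) (d : ℂ) :
    shiftedProd X (l.map f) d = shiftedProd (fun c b => X c (f b)) l d := by
  induction l generalizing d with
  | nil => rfl
  | cons a l ih => rw [List.map_cons, shiftedProd, ih, shiftedProd]

theorem shiftedProd_congr {X X' : ℂ → ι → B} {l : List ι} (h : ∀ b ∈ l, ∀ c, X c b = X' c b)
    (d : ℂ) : shiftedProd X l d = shiftedProd X' l d := by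
  induction l generalizing d with
  | nil => rfl
  | cons a l ih =>
    rw [shiftedProd, shiftedProd, h a List.mem_cons_self,
      ih fun b hb => h b (List.mem_cons_of_mem _ hb)]

theorem commute_shiftedProd {y : B} {X : ℂ → ι → B} (h : ∀ c b, Commute y (X c b)) (l : List ι)
    (d : ℂ) : Commute y (shiftedProd X l d) := by
  induction l generalizing d with
  | nil => exact Commute.one_right y
  | cons a l ih => exact (h _ _).mul_right (ih _)

end ShiftedProd

/-! ### Entries of shifted products, cofactors and the expansion of the determinant -/

section Entries

variable {A : Type*} [Ring A] [Algebra ℂ A] {n m N : ℕ}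

theorem shiftedProd_copies_apply (S : Matrix (Fin n) (Fin n) (PowerSeries A)) {l : List (Fin N)}
    (hl : l.Nodup) (d : ℂ) (I J : Fin N → Fin n) :
    shiftedProd (copies N S) l d I J =
      if ∀ b, b ∉ l → I b = J b then shiftedProd (fun c b => shift c (S (I b) (J b))) l d
      else 0 := by
  induction l generalizing d I with
  | nil => simp [shiftedProd, Matrix.one_apply, funext_iff]
  | cons a l ih =>
    obtain ⟨ha, hl⟩ := List.nodup_cons.1 hl
    rw [shiftedProd, copies, onCopy_mul_apply, Finset.sum_eq_single (J a)]
    · rw [ih hl, shiftedProd, mul_ite, mul_zero]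
      refine if_congr ⟨fun h c hc => ?_, fun h c hc => ?_⟩ ?_ rfl
      · rw [List.mem_cons, not_or] at hc
        rw [← h c hc.2, Function.update_of_ne hc.1]
      · by_cases hca : c = a
        · rw [hca, Function.update_self]
        · rw [Function.update_of_ne hca, h c (by simp [hca, hc])]
      · rw [Matrix.map_apply]
        congr 1
        refine shiftedProd_congr (fun b hb c => ?_) _
        rw [Function.update_of_ne (ne_of_mem_of_not_mem hb ha)]
    · intro k _ hk
      rw [ih hl, if_neg, mul_zero]
      intro h
      exact hk (by simpa using h a ha)
    · simp

theorem antisymmetrizer_mul_apply {R : Type*} [Ring R]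
    (M : Matrix (Fin m → Fin n) (Fin m → Fin n) R) (I J : Fin m → Fin n) :
    (antisymmetrizer R n m * M) I J = ∑ σ : Perm (Fin m), (Perm.sign σ : ℤ) • M (I ∘ σ) J := by
  rw [antisymmetrizer_eq_sum, Finset.sum_mul, Matrix.sum_apply]
  refine Finset.sum_congr rfl fun σ _ => ?_
  rw [smul_mul_assoc, Matrix.smul_apply, permHom_mul_apply]

theorem qdet_eq_sum (S : Matrix (Fin m) (Fin m) (PowerSeries A)) :
    qdet S = ∑ σ : Perm (Fin m), (Perm.sign σ : ℤ) •
      shiftedProd (fun c b => shift c (S (σ b) b)) (List.finRange m) 0 := by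
  rw [qdet, antisymmetrizer_mul_apply]
  refine Finset.sum_congr rfl fun σ _ => ?_
  rw [copiesProd, shiftedProd_copies_apply _ (List.nodup_finRange m), if_pos]
  · rfl
  · exact fun b hb => absurd (List.mem_finRange b) hb

theorem commute_qdet {S : Matrix (Fin m) (Fin m) (PowerSeries A)} {y : PowerSeries A}
    (h : ∀ i j c, Commute y (shift c (S i j))) : Commute y (qdet S) := by
  rw [qdet_eq_sum]
  exact Commute.sum_right _ _ _ fun σ _ =>
    (commute_shiftedProd (fun c b => h _ _ c) _ _).smul_right _

theorem constantCoeff_qdet {S : Matrix (Fin m) (Fin m) (PowerSeries A)} (hS : IsYangianMatrix S) :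
    constantCoeff (qdet S) = 1 := by
  have h (σ : Perm (Fin m)) (l : List (Fin m)) (d : ℂ) :
      constantCoeff (shiftedProd (fun c b => shift c (S (σ b) b)) l d) =
        if ∀ b ∈ l, σ b = b then 1 else 0 := by
    induction l generalizing d with
    | nil => simp [shiftedProd]
    | cons a l ih =>
      rw [shiftedProd, map_mul, ih, constantCoeff_shift, hS.constantCoeff_eq]
      simp [← ite_and, and_comm]
  rw [qdet_eq_sum, map_sum, Finset.sum_eq_single 1]
  · rw [Perm.sign_one, Units.val_one, one_smul, h]
    simp
  · intro σ _ hσ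
    rw [map_zsmul, h, if_neg, smul_zero]
    exact fun e => hσ (Equiv.ext fun b => e b (List.mem_finRange b))
  · simp

theorem qdet_of_size_zero (S : Matrix (Fin 0) (Fin 0) (PowerSeries A)) : qdet S = 1 := by
  simp [qdet_eq_sum, shiftedProd]

theorem qdet_of_size_one (S : Matrix (Fin 1) (Fin 1) (PowerSeries A)) : qdet S = S 0 0 := by
  simp [qdet_eq_sum, shiftedProd, shift_zero, List.finRange_succ]

/-- The permutations of `{0, …, k}` as pairs of the image of the last element and a permutation
of the other ones. -/
def decomposeLast (k : ℕ) : Option (Fin k) × Perm (Fin k) ≃ Perm (Fin (k + 1)) :=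
  Perm.decomposeOption.symm.trans (Equiv.permCongr (finSuccEquivLast (n := k)).symm)

theorem decomposeLast_some_last {k : ℕ} (c : Fin k) (τ : Perm (Fin k)) :
    decomposeLast k (some c, τ) (Fin.last k) = c.castSucc := by
  simp [decomposeLast, Equiv.permCongr_apply]

theorem decomposeLast_none_last {k : ℕ} (τ : Perm (Fin k)) :
    decomposeLast k (none, τ) (Fin.last k) = Fin.last k := by
  simp [decomposeLast, Equiv.permCongr_apply]

theorem decomposeLast_none_castSucc {k : ℕ} (τ : Perm (Fin k)) (b : Fin k) :
    decomposeLast k (none, τ) b.castSucc = (τ b).castSucc := by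
  simp [decomposeLast, Equiv.permCongr_apply]

theorem sign_decomposeLast_none {k : ℕ} (τ : Perm (Fin k)) :
    Perm.sign (decomposeLast k (none, τ)) = Perm.sign τ := by
  simp [decomposeLast]

/-- The entries of the last row of the quantum comatrix. -/
noncomputable def comatrixLast {k : ℕ} (S : Matrix (Fin (k + 1)) (Fin (k + 1)) (PowerSeries A))
    (i : Fin (k + 1)) : PowerSeries A :=
  (antisymmetrizer (PowerSeries A) (k + 1) (k + 1) *
    shiftedProd (copies (k + 1) S) ((List.finRange k).map Fin.castSucc) 0) id
      (Function.update id (Fin.last k) i)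

/-- The product does not act on the last copy, so only permutations fixing the last index
contribute. -/
theorem comatrixLast_last {k : ℕ} (S : Matrix (Fin (k + 1)) (Fin (k + 1)) (PowerSeries A)) :
    comatrixLast S (Fin.last k) = qdet (S.submatrix Fin.castSucc Fin.castSucc) := by
  have hu : Function.update id (Fin.last k) (Fin.last k) = (id : Fin (k + 1) → Fin (k + 1)) :=
    Function.update_eq_self (Fin.last k) id
  have hmem (b : Fin (k + 1)) : b ∉ (List.finRange k).map Fin.castSucc ↔ b = Fin.last k := by
    refine Fin.lastCases (by simp [Fin.castSucc_ne_last]) (fun i => ?_) b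
    simp [Fin.castSucc_ne_last]
  have hnd : ((List.finRange k).map Fin.castSucc).Nodup :=
    (List.nodup_finRange k).map (Fin.castSucc_injective k)
  rw [comatrixLast, hu, antisymmetrizer_mul_apply, ← (decomposeLast k).sum_comp,
    Fintype.sum_prod_type, Fintype.sum_option, qdet_eq_sum]
  simp only [shiftedProd_copies_apply _ hnd, hmem, forall_eq, Function.comp_apply, id,
    decomposeLast_some_last, decomposeLast_none_last, Fin.castSucc_ne_last, if_false, smul_zero,
    Finset.sum_const_zero, add_zero, if_true, sign_decomposeLast_none, shiftedProd_map,
    decomposeLast_none_castSucc, Matrix.submatrix_apply]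

/-- Multiplication by the last factor S_{k+1}(u - k) completes the antisymmetrized product. For j
other than the last index the column multi-index repeats j, and alternation on the right gives 0. -/
theorem sum_comatrixLast_mul {k : ℕ} {S : Matrix (Fin (k + 1)) (Fin (k + 1)) (PowerSeries A)}
    (hS : IsYangianMatrix S) (j : Fin (k + 1)) :
    ∑ i, comatrixLast S i * shift (k : ℂ) (S i j) = if j = Fin.last k then qdet S else 0 := by
  have hP : copiesProd S = shiftedProd (copies (k + 1) S) ((List.finRange k).map Fin.castSucc) 0 *
      copies (k + 1) S k (Fin.last k) := by
    rw [copiesProd, List.finRange_succ_last, shiftedProd_append]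
    simp [shiftedProd]
  have e : (antisymmetrizer (PowerSeries A) (k + 1) (k + 1) * copiesProd S) id
      (Function.update id (Fin.last k) j) =
        ∑ i, comatrixLast S i * shift (k : ℂ) (S i j) := by
    rw [hP, ← mul_assoc, copies, mul_onCopy_apply]
    simp only [comatrixLast, Function.update_idem, Function.update_self, Matrix.map_apply]
  rw [← e]
  split_ifs with h
  · rw [h, qdet, show Function.update id (Fin.last k) (Fin.last k) = id from
      Function.update_eq_self (Fin.last k) id]
  · refine apply_eq_zero_of_not_injective_right
      (fun b c hbc => hS.antisymmetrizer_mul_copiesProd_mul_swap hbc) _ fun hinj => h ?_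
    apply hinj
    rw [Function.update_self, Function.update_of_ne h, id]

end Entries

/-! ### Invertibility and quasi-determinants -/

section QuasiDeterminant

variable {R : Type*} [Ring R]

/-- Series with matrix coefficients as matrices of series. -/
noncomputable def matrixOfSeries (m : ℕ) :
    PowerSeries (Matrix (Fin m) (Fin m) R) →+* Matrix (Fin m) (Fin m) (PowerSeries R) where
  toFun f := Matrix.of fun i j => mk fun N => coeff N f i j
  map_one' := by
    ext i j N
    rw [Matrix.of_apply, coeff_mk, coeff_one, Matrix.one_apply]
    split_ifs with h1 h2 h2 <;> simp [coeff_one, Matrix.one_apply, h1, h2]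
  map_zero' := by ext i j N; simp
  map_add' f g := by ext i j N; simp
  map_mul' f g := by
    ext i j N
    simp only [Matrix.of_apply, coeff_mk, Matrix.mul_apply, coeff_mul, map_sum, Matrix.sum_apply]
    exact Finset.sum_comm

/-- Such a matrix is the image of a series over the matrix ring with constant term 1, and series of
that kind are invertible even over noncommutative rings. -/
theorem isUnit_matrix_of_constantCoeff {m : ℕ} {Z : Matrix (Fin m) (Fin m) (PowerSeries R)}
    (h : ∀ i j, constantCoeff (Z i j) = if i = j then 1 else 0) : IsUnit Z := by
  let f : PowerSeries (Matrix (Fin m) (Fin m) R) := mk fun N => Matrix.of fun i j => coeff N (Z i j)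
  have hf : matrixOfSeries m f = Z := by
    ext i j N
    simp [matrixOfSeries, f]
  rw [← hf]
  refine (isUnit_of_constantCoeff_eq_one ?_).map _
  ext i j
  rw [← coeff_zero_eq_constantCoeff_apply, coeff_mk, Matrix.of_apply,
    coeff_zero_eq_constantCoeff_apply, h, Matrix.one_apply]

theorem apply_eq_mul_inverse {m : ℕ} {Z : Matrix (Fin m) (Fin m) R} (hZ : IsUnit Z)
    {h : Fin m → R} {j₀ : Fin m} {D : R}
    (e : ∀ j, ∑ i, h i * Z i j = if j = j₀ then D else 0) (i : Fin m) :
    h i = D * Ring.inverse Z j₀ i := by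
  have e' : Matrix.vecMul h Z = Pi.single j₀ D := by
    funext j
    rw [Pi.single_apply, ← e j]
    rfl
  calc h i = Matrix.vecMul (Matrix.vecMul h Z) (Ring.inverse Z) i := by
        rw [Matrix.vecMul_vecMul, Ring.mul_inverse_cancel _ hZ, Matrix.vecMul_one]
    _ = _ := by rw [e', Matrix.single_vecMul]; rfl

theorem hasQuasiDet_of_mul {m : ℕ} {Z : Matrix (Fin m) (Fin m) R} (hZ : IsUnit Z) {i j : Fin m}
    {D D' : Rˣ} (h : (D' : R) = D * Ring.inverse Z j i) :
    HasQuasiDet Z i j ∧ quasiDet Z i j = ↑(D'⁻¹ * D) := by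
  have e : Ring.inverse Z j i = ↑(D⁻¹ * D') := by
    rw [Units.val_mul, h, Units.inv_mul_cancel_left]
  refine ⟨⟨hZ, e ▸ Units.isUnit _⟩, ?_⟩
  rw [quasiDet, e, Ring.inverse_unit, mul_inv_rev, inv_inv]

variable {A : Type*} [Ring A] [Algebra ℂ A]

theorem IsYangianMatrix.isUnit_map_shift {m : ℕ} {S : Matrix (Fin m) (Fin m) (PowerSeries A)}
    (hS : IsYangianMatrix S) (c : ℂ) : IsUnit (S.map (shift c)) :=
  isUnit_matrix_of_constantCoeff fun i j => by
    rw [Matrix.map_apply, constantCoeff_shift, hS.constantCoeff_eq]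

theorem qdet_submatrix_castSucc {k : ℕ} {S : Matrix (Fin (k + 1)) (Fin (k + 1)) (PowerSeries A)}
    (hS : IsYangianMatrix S) :
    qdet (S.submatrix Fin.castSucc Fin.castSucc) =
      qdet S * Ring.inverse (S.map (shift (k : ℂ))) (Fin.last k) (Fin.last k) := by
  rw [← comatrixLast_last]
  exact apply_eq_mul_inverse (hS.isUnit_map_shift k) (sum_comatrixLast_mul hS) _

end QuasiDeterminant

/-! ### Telescoping over the leading submatrices -/

section Main

variable (n : ℕ)

/-- The series `qdet T^{(k)}(u)`. -/
noncomputable def principalQdet (k : ℕ) (hk : k ≤ n) : PowerSeries (Y n) :=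
  qdet ((T n).submatrix (Fin.castLE hk) (Fin.castLE hk))

theorem isYangianMatrix_principal (k : ℕ) (hk : k ≤ n) :
    IsYangianMatrix ((T n).submatrix (Fin.castLE hk) (Fin.castLE hk)) :=
  (isYangianMatrix_T n).submatrix (Fin.castLE_injective hk)

theorem isUnit_principalQdet (k : ℕ) (hk : k ≤ n) : IsUnit (principalQdet n k hk) :=
  isUnit_of_constantCoeff_eq_one (constantCoeff_qdet (isYangianMatrix_principal n k hk))

/-- `principalQdet` as a unit. -/
noncomputable def principalQdetUnit (k : ℕ) (hk : k ≤ n) : (PowerSeries (Y n))ˣ :=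
  (isUnit_principalQdet n k hk).unit

theorem coe_principalQdetUnit (k : ℕ) (hk : k ≤ n) :
    (principalQdetUnit n k hk : PowerSeries (Y n)) = principalQdet n k hk := rfl

theorem commute_principalQdet (k l : ℕ) (hk : k ≤ n) (hl : l ≤ n) :
    Commute (principalQdetUnit n k hk) (principalQdetUnit n l hl) := by
  wlog h : k ≤ l generalizing k l
  · exact (this l k hl hk (Nat.le_of_not_le h)).symm
  rw [← Commute.units_val_iff]
  -- For k ≤ l the smaller determinant is a polynomial in shifted entries of the larger matrix, with
  -- which the larger determinant commutes.
  refine (commute_qdet fun i j c => ?_).symm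
  exact ((isYangianMatrix_principal n l hl).commute_shift_qdet (Fin.castLE h i) (Fin.castLE h j)
    c).symm

theorem principalQdet_eq_mul_inverse (k : Fin n) :
    principalQdet n k.val k.isLt.le = principalQdet n (k.val + 1) k.isLt *
      Ring.inverse (leadingT n k) (Fin.last k.val) (Fin.last k.val) := by
  have h := qdet_submatrix_castSucc (isYangianMatrix_principal n (k.val + 1) k.isLt)
  have e : leadingT n k = ((T n).submatrix (Fin.castLE k.isLt) (Fin.castLE k.isLt)).map
      (shift (k.val : ℂ)) := rfl
  rw [Matrix.submatrix_submatrix] at h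
  rw [e, principalQdet, principalQdet, ← h]
  rfl

theorem factor_spec (k : Fin n) :
    HasQuasiDet (leadingT n k) (Fin.last k.val) (Fin.last k.val) ∧
      factor n k =
        ↑((principalQdetUnit n k.val k.isLt.le)⁻¹ * principalQdetUnit n (k.val + 1) k.isLt) := by
  have hZ : IsUnit (leadingT n k) :=
    (isYangianMatrix_principal n (k.val + 1) k.isLt).isUnit_map_shift k.val
  have h : (principalQdetUnit n k.val k.isLt.le : PowerSeries (Y n)) =
      principalQdetUnit n (k.val + 1) k.isLt *
        Ring.inverse (leadingT n k) (Fin.last k.val) (Fin.last k.val) := by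
    rw [coe_principalQdetUnit, coe_principalQdetUnit]
    exact principalQdet_eq_mul_inverse n k
  have := hasQuasiDet_of_mul hZ h
  rwa [factor]

theorem prod_factor (k : ℕ) (hk : k ≤ n) :
    (List.ofFn fun i : Fin k => factor n (Fin.castLE hk i)).prod = principalQdetUnit n k hk := by
  induction k with
  -- The telescoping starts at D_0 = 1.
  | zero => exact (qdet_of_size_zero _).symm
  | succ k ih =>
    rw [List.ofFn_succ', List.concat_eq_append, List.prod_append, List.prod_singleton]
    have := ih (Nat.le_of_succ_le hk)
    rw [show (fun i : Fin k => factor n (Fin.castLE hk i.castSucc)) =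
      fun i : Fin k => factor n (Fin.castLE (Nat.le_of_succ_le hk) i) from rfl, this,
      (factor_spec n _).2, ← Units.val_mul]
    exact congrArg _ (mul_inv_cancel_left _ _)

theorem tList_eq :
    tList n = List.ofFn fun a : Fin n => copies n (T n) (0 + a.val) (id a) := by
  simp only [zero_add]
  rfl

theorem isQuantumDeterminant_qdet : IsQuantumDeterminant n (qdet (T n)) := by
  have hS := isYangianMatrix_T n
  have h1 : (tList n).prod = copiesProd (T n) := by
    rw [tList_eq, ← shiftedProd_ofFn, List.ofFn_id, copiesProd]
  have h2 : (tList n).reverse.prod =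
      shiftedProdRev (copies n (T n)) (List.finRange n) 0 := by
    rw [tList_eq, ← shiftedProdRev_ofFn, List.ofFn_id]
  refine ⟨constantCoeff_qdet hS, ?_, ?_⟩
  · rw [h1, hS.antisymmetrizer_mul_copiesProd_eq]
  · rw [h2, ← hS.antisymmetrizer_mul_copiesProd, hS.antisymmetrizer_mul_copiesProd_eq]

theorem isQuantumDeterminant_iff (D : PowerSeries (Y n)) :
    IsQuantumDeterminant n D ↔ D = qdet (T n) := by
  refine ⟨fun h => ?_, fun h => h ▸ isQuantumDeterminant_qdet n⟩
  rw [← antisymmetrizer_mul_scalar_id _ n D, ← h.antisymmetrizer_mul,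
    (isQuantumDeterminant_qdet n).antisymmetrizer_mul, antisymmetrizer_mul_scalar_id]

end Main

end Yangian

/-- The quantum determinant exists and is unique; all the quasi-determinants
`|T^{(m)}(u - m + 1)|_{mm}` are defined, the one for `m = 1` being `t_{11}(u)`; the quantum
determinant is the product of these in the order `m = 1, …, n`; and they commute pairwise. -/
theorem mainTheorem6 (n : ℕ) (hn : 1 ≤ n) :
    (∃! D : PowerSeries (Yangian.Y n), Yangian.IsQuantumDeterminant n D) ∧
    (∀ k : Fin n, Yangian.HasQuasiDet (Yangian.leadingT n k) (Fin.last k.val) (Fin.last k.val)) ∧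
    Yangian.factor n ⟨0, hn⟩ = Yangian.T n ⟨0, hn⟩ ⟨0, hn⟩ ∧
    (∀ D : PowerSeries (Yangian.Y n), Yangian.IsQuantumDeterminant n D →
      D = (List.ofFn (Yangian.factor n)).prod) ∧
    (∀ k l : Fin n, Commute (Yangian.factor n k) (Yangian.factor n l)) := by
  refine ⟨⟨Yangian.qdet (Yangian.T n), Yangian.isQuantumDeterminant_qdet n,
    fun D h => (Yangian.isQuantumDeterminant_iff n D).1 h⟩,
    fun k => (Yangian.factor_spec n k).1, ?_, fun D h => ?_, fun k l => ?_⟩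
  -- The first factor is the partial product of length one, that is D_1 = t_11(u).
  · have h := Yangian.prod_factor n 1 hn
    rw [List.ofFn_succ, List.ofFn_zero, List.prod_singleton] at h
    exact h.trans (Yangian.qdet_of_size_one _)
  · rw [(Yangian.isQuantumDeterminant_iff n D).1 h]
    exact (Yangian.prod_factor n n le_rfl).symm
  · rw [(Yangian.factor_spec n k).2, (Yangian.factor_spec n l).2, Commute.units_val_iff]
    have h := Yangian.commute_principalQdet n
    exact ((h _ _ _ _).inv_inv.mul_right (h _ _ _ _).inv_left).mul_left
      ((h _ _ _ _).inv_right.mul_right (h _ _ _ _))
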